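/- Let $N, Q_0, Q_1, w > 0$ be real numbers and let $n \ge 0$ be an integer with $n < N + NQ_0 + \tfrac12$ (in particular, any $n \le N + NQ_0$ is allowed). Let $P$ be a complex polynomial of degree at most $n$ (for instance the monic orthogonal polynomial $P_{n,N}$ of degree $n$). Let $\Gamma$ be a simple closed piecewise $C^1$ contour with positive orientation which has $[0,w]$ in its interior and $(-\infty,-1/w]$ in its exterior. Then the planar orthogonality $$\int_{\mathbb C} P(z)\,\overline{(z-w)}^{\,k}\,\frac{|z-w|^{2NQ_1}}{(1+|z|^2)^{N(1+Q_0+Q_1)+1}}\,dA(z)=0,\qquad k=0,\dots,n-1,$$ where $dA$ is Lebesgue measure on $\mathbb C$ and the integrals converge absolutely, holds if and only if the non-Hermitian contour orthogonality $$\oint_{\Gamma} P(z)\,z^{j}\,\frac{(z-w)^{NQ_1}}{(1+zw)^{N+NQ_0}}\,\frac{dz}{z^{n+NQ_1}}=0,\qquad j=0,\dots,n-1,$$ holds. Here the powers are principal ones; the quotient $(z-w)^{NQ_1}(1+zw)^{-N-NQ_0}z^{-n-NQ_1}$ is then analytic in $\mathbb C\setminus\big((-\infty,-1/w]\cup[0,w]\big)$.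 In particular, planar orthogonality implies the contour relations for $j=1,\dots,n-1$ on every such $\Gamma$. -/

import Mathlib

open scoped unitInterval

noncomputable section

namespace ContourOrth

/-! ### Contours in the complex plane -/

/-- The complex line integral `∮_γ f(z) dz`, as Mathlib's curve integral of the
`1`-form `f(z) dz`. -/
def contourIntegral {a b : ℂ} (γ : Path a b) (f : ℂ → ℂ) : ℂ :=
  curveIntegral (fun z : ℂ => f z • ContinuousLinearMap.id ℂ ℂ) γ

/-- The `1`-form `f(z) dz` is integrable along `γ`. -/
def ContourIntegrable {a b : ℂ} (γ : Path a b) (f : ℂ → ℂ) : Prop :=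
  CurveIntegrable (fun z : ℂ => f z • ContinuousLinearMap.id ℂ ℂ) γ

/-- `γ` is piecewise `C¹`: `[0,1]` is a finite union of consecutive closed intervals on each of
which `γ` is continuously differentiable (one-sidedly at the endpoints). -/
def PiecewiseC1 {a b : ℂ} (γ : Path a b) : Prop :=
  ∃ (m : ℕ) (t : ℕ → ℝ), StrictMono t ∧ t 0 = 0 ∧ t m = 1 ∧
    ∀ i < m, ContDiffOn ℝ 1 γ.extend (Set.Icc (t i) (t (i + 1)))

/-- The closed path `γ` is simple: it does not meet itself, apart from its two endpoints. -/
def SimpleClosed {a : ℂ} (γ : Path a a) : Prop :=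
  ∀ s t : I, s < t → γ s = γ t → s = 0 ∧ t = 1

/-- The interior of `γ`: the union of the bounded connected components of the complement. -/
def interiorOf {a b : ℂ} (γ : Path a b) : Set ℂ :=
  {z | z ∉ Set.range γ ∧ Bornology.IsBounded (connectedComponentIn (Set.range γ)ᶜ z)}

/-- The exterior of `γ`: the union of the unbounded connected components of the complement
(there is exactly one of them). -/
def exteriorOf {a b : ℂ} (γ : Path a b) : Set ℂ :=
  {z | z ∉ Set.range γ ∧ ¬ Bornology.IsBounded (connectedComponentIn (Set.range γ)ᶜ z)}

/-- The winding number (index) of the closed path `γ` about `p`. -/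
def windingNumber {a : ℂ} (γ : Path a a) (p : ℂ) : ℂ :=
  (2 * Real.pi * Complex.I)⁻¹ * contourIntegral γ (fun z => (z - p)⁻¹)

/-- `γ` is positively oriented: it winds exactly once, counterclockwise, about each point of its
interior. -/
def PositivelyOriented {a : ℂ} (γ : Path a a) : Prop :=
  ∀ p ∈ interiorOf γ, windingNumber γ p = 1

/-- `γ` is a positively oriented, simple, closed, piecewise `C¹` contour with `[0, w]` in its
interior and `(-∞, -1/w]` in its exterior. -/
structure IsAdmissibleContour (w : ℝ) {a : ℂ} (γ : Path a a) : Prop where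
  piecewiseC1 : PiecewiseC1 γ
  simple : SimpleClosed γ
  positive : PositivelyOriented γ
  interior : ∀ x : ℝ, 0 ≤ x → x ≤ w → (x : ℂ) ∈ interiorOf γ
  exterior : ∀ x : ℝ, x ≤ -1 / w → (x : ℂ) ∈ exteriorOf γ

/-! ### The two orthogonality relations -/

/-- The planar weight `|z - w|^{2 N Q₁} / (1 + |z|²)^{N (1 + Q₀ + Q₁) + 1}`. -/
def planarWeight (N Q₀ Q₁ w : ℝ) (z : ℂ) : ℝ :=
  ‖z - (w : ℂ)‖ ^ (2 * N * Q₁) / (1 + ‖z‖ ^ 2) ^ (N * (1 + Q₀ + Q₁) + 1)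

/-- The integrand `P(z) conj(z - w)^k |z - w|^{2 N Q₁} / (1 + |z|²)^{N (1 + Q₀ + Q₁) + 1}`. -/
def planarIntegrand (N Q₀ Q₁ w : ℝ) (P : Polynomial ℂ) (k : ℕ) (z : ℂ) : ℂ :=
  P.eval z * (starRingEnd ℂ (z - (w : ℂ))) ^ k * (planarWeight N Q₀ Q₁ w z : ℂ)

/-- Planar orthogonality of `P` to all polynomials of degree less than `n`, tested on the
basis `(z - w)^k`, `0 ≤ k ≤ n - 1`; the area measure is Lebesgue measure on `ℂ`. -/
def PlanarOrthogonal (N Q₀ Q₁ w : ℝ) (n : ℕ) (P : Polynomial ℂ) : Prop :=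
  ∀ k < n, MeasureTheory.Integrable (planarIntegrand N Q₀ Q₁ w P k) ∧
    ∫ z : ℂ, planarIntegrand N Q₀ Q₁ w P k z = 0

/-- The contour weight `(z - w)^{N Q₁} / ((1 + z w)^{N + N Q₀} z^{n + N Q₁})`, with principal
powers. Because `n` is an integer, the jumps of the principal powers `(z - w)^{N Q₁}` and
`z^{n + N Q₁}` across `(-∞, 0)` cancel (also at the points of `(-∞, 0)`, where both arguments
are `π`), so that this is the branch which is analytic in `ℂ \ ((-∞, -1/w] ∪ [0, w])`; see
`contourWeight_eq`. -/
def contourWeight (N Q₀ Q₁ w : ℝ) (n : ℕ) (z : ℂ) : ℂ :=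
  (z - (w : ℂ)) ^ ((N * Q₁ : ℝ) : ℂ) /
    ((1 + z * (w : ℂ)) ^ ((N + N * Q₀ : ℝ) : ℂ) * z ^ ((n + N * Q₁ : ℝ) : ℂ))

open Complex in
/-- Off `[0, w]` the contour weight is `(1 - w/z)^{N Q₁} / ((1 + z w)^{N + N Q₀} z^n)`, whose only
branch cuts are `[0, w]` and `(-∞, -1/w]`. -/
theorem contourWeight_eq (N Q₀ Q₁ w : ℝ) (hw : 0 < w) (n : ℕ) (z : ℂ)
    (hz : ∀ x : ℝ, 0 ≤ x → x ≤ w → z ≠ (x : ℂ)) :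
    contourWeight N Q₀ Q₁ w n z =
      (1 - (w : ℂ) / z) ^ ((N * Q₁ : ℝ) : ℂ) /
        ((1 + z * (w : ℂ)) ^ ((N + N * Q₀ : ℝ) : ℂ) * z ^ n) := by
  have h0 : z ≠ 0 := by simpa using hz 0 le_rfl hw.le
  have h1 : z - w ≠ 0 := sub_ne_zero.2 (hz w hw.le le_rfl)
  have harg : arg (z - w) + -arg z ∈ Set.Ioc (-Real.pi) Real.pi := by
    have A := arg_mem_Ioc (z-w)
    have B := arg_mem_Ioc z
    rcases lt_trichotomy z.im 0 with h | h | h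
    · have a1 : arg (z - w) < 0 := arg_neg_iff.2 (by simpa using h)
      have b1 : arg z < 0 := arg_neg_iff.2 h
      constructor <;> [linarith [A.1]; linarith [B.1]]
    · have hz' : z = (z.re : ℂ) := by apply Complex.ext <;> simp [h]
      rcases lt_or_ge z.re 0 with h2 | h2
      · rw [hz', ← ofReal_sub, arg_ofReal_of_neg h2, arg_ofReal_of_neg (by linarith)]
        constructor <;> linarith [Real.pi_pos]
      · have h3 : w < z.re := by
          by_contra hc
          exact hz z.re h2 (not_lt.1 hc) hz'
        rw [hz', ← ofReal_sub, arg_ofReal_of_nonneg h2, arg_ofReal_of_nonneg (by linarith)]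
        constructor <;> linarith [Real.pi_pos]
    · have a1 : 0 ≤ arg (z - w) := arg_nonneg_iff.2 (by simpa using h.le)
      have b1 : 0 ≤ arg z := arg_nonneg_iff.2 h.le
      constructor
      · rcases eq_or_lt_of_le B.2 with hb | hb
        · have := (arg_eq_pi_iff.1 hb).2; linarith
        · linarith
      · linarith [A.2]
  have hne : 1 - (w : ℂ) / z ≠ 0 := by
    have e : 1 - (w : ℂ) / z = (z - w) / z := by field_simp
    rw [e]
    exact div_ne_zero h1 h0
  have hlog : log (1 - (w : ℂ) / z) = log (z - w) - log z := by
    have e : exp (log (z - w) - log z) = 1 - (w : ℂ) / z := by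
      rw [exp_sub, exp_log h1, exp_log h0]
      field_simp
    rw [← e, log_exp]
    · simpa [sub_eq_add_neg, log_im] using harg.1
    · simpa [sub_eq_add_neg, log_im] using harg.2
  have key : (1 - (w : ℂ) / z) ^ ((N * Q₁ : ℝ) : ℂ) * z ^ ((N * Q₁ : ℝ) : ℂ) =
      (z - (w : ℂ)) ^ ((N * Q₁ : ℝ) : ℂ) := by
    rw [cpow_def_of_ne_zero hne, cpow_def_of_ne_zero h0, cpow_def_of_ne_zero h1, hlog,
      ← exp_add]
    ring_nf
  have hz2 : z ^ ((n + N * Q₁ : ℝ) : ℂ) = z ^ n * z ^ ((N * Q₁ : ℝ) : ℂ) := by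
    rw [ofReal_add, cpow_add _ _ h0, ofReal_natCast, cpow_natCast]
  have hz3 : z ^ ((N * Q₁ : ℝ) : ℂ) ≠ 0 := by
    simp [cpow_eq_zero_iff, h0]
  rw [contourWeight, hz2, ← key, ← mul_assoc, mul_div_mul_right _ _ hz3]

/-- Non-Hermitian orthogonality of `P` on the contour `γ`, tested on `z^j`, `0 ≤ j ≤ n - 1`. -/
def ContourOrthogonal (N Q₀ Q₁ w : ℝ) (n : ℕ) (P : Polynomial ℂ) {a : ℂ} (γ : Path a a) : Prop :=
  ∀ j < n, ContourIntegrable γ (fun z => P.eval z * z ^ j * contourWeight N Q₀ Q₁ w n z) ∧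
    contourIntegral γ (fun z => P.eval z * z ^ j * contourWeight N Q₀ Q₁ w n z) = 0

end ContourOrth

end

noncomputable section

namespace ContourOrth

open MeasureTheory Set Filter Topology Interval
open scoped ComplexConjugate

/-! ### Line integrals along piecewise `C¹` paths -/

/-! Fix `k < n` and put `q = N Q₁`, `m = N + N Q₀ - k`. The planar integrand `f` has two explicit
`∂̄`-primitives, both functions of the variable `s = (1 + z w)/(1 + |z|²)`, for which `1 - s = z (z̄
- w)/(1 + |z|²)`. One is built on the incomplete Beta integral started at `s = 1`; it is regular
away from `(-∞, -1/w]`. The other is built on the integral started at `s = 0`; it is regular away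
from `[0, w]` and is `O(|z|^(-(2m+k-n)-1))` at infinity. The two incomplete integrals add up to a
complete Beta integral `B ≠ 0`, so off both cuts the primitives differ by `B` times a holomorphic
kernel `P(z) (1 - w/z)^q z^(-k-1) (1 + z w)^(-m)` (`innerPotential_sub_outerPotential`).

Stokes' theorem with the first primitive on a rectangle around `[0, w]` and with the second outside
it gives `2i ∫ f = B ∮ kernel` over the rectangle's boundary, since the decay kills the boundary
term at infinity (`integral_planarDensity_eq`). The rectangle may be replaced by any admissible
contour: subtracting a suitable multiple of `1/z` leaves a function with a primitive on the doubly
cut plane, and `1/z` is controlled by the winding number about `0`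
(`IsAdmissibleContour.contourIntegral_eq_rectIntegral`).

Finally `(1 + z w)^(-m) = (1 + z w)^k (1 + z w)^(-N - N Q₀)`. Expanding the binomial turns the `n`
kernel relations into a unitriangular linear system in the `n` contour moments, so both families
vanish together (`forall_binomial_sum_eq_zero_iff`). -/

theorem curveIntegralFun_smul_id {a b : ℂ} (γ : Path a b) (f : ℂ → ℂ) (t : ℝ) :
    curveIntegralFun (fun z : ℂ => f z • ContinuousLinearMap.id ℂ ℂ) γ t =
      f (γ.extend t) * derivWithin γ.extend I t := by
  rw [curveIntegralFun_def]; simp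

/-- Inside each open piece the derivative within `[0, 1]` agrees with the derivative within the
closed piece, which is continuous up to the endpoints. The breakpoints form a null set. -/
theorem PiecewiseC1.contourIntegrable {a b : ℂ} {γ : Path a b} (hγ : PiecewiseC1 γ) {f : ℂ → ℂ}
    (hf : ContinuousOn f (range γ)) : ContourIntegrable γ f := by
  obtain ⟨m, t, ht, h0, h1, hC⟩ := hγ
  rw [ContourIntegrable, CurveIntegrable, ← h0, ← h1]
  refine IntervalIntegrable.trans_iterate fun i hi => ?_
  have hlt : t i < t (i + 1) := ht (Nat.lt_succ_self i)
  have hsub : Ioo (t i) (t (i + 1)) ⊆ Ioo 0 1 := by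
    rw [← h0, ← h1]
    exact Ioo_subset_Ioo (ht.monotone (Nat.zero_le i)) (ht.monotone hi)
  have hc : ContinuousOn (fun x => f (γ.extend x) *
      derivWithin γ.extend (Icc (t i) (t (i + 1))) x) (Icc (t i) (t (i + 1))) := by
    refine ContinuousOn.mul ?_ ((hC i hi).continuousOn_derivWithin (uniqueDiffOn_Icc hlt) le_rfl)
    refine hf.comp γ.continuous_extend.continuousOn fun x _ => ?_
    rw [← γ.extend_range]
    exact mem_range_self x
  have h2 := hc.intervalIntegrable_of_Icc (μ := volume) hlt.le
  rw [intervalIntegrable_iff_integrableOn_Ioo_of_le hlt.le] at h2 ⊢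
  refine h2.congr_fun (fun x hx => ?_) measurableSet_Ioo
  rw [curveIntegralFun_smul_id]
  simp only
  rw [derivWithin_of_mem_nhds (Icc_mem_nhds hx.1 hx.2),
    derivWithin_of_mem_nhds (Icc_mem_nhds (hsub hx).1 (hsub hx).2)]

theorem exists_mem_Ico_of_lt (t : ℕ → ℝ) (x : ℝ) (h0 : t 0 ≤ x) (m : ℕ) (hm : x < t m) :
    ∃ i < m, t i ≤ x ∧ x < t (i + 1) := by
  induction m with
  | zero => exact absurd hm (not_lt.2 h0)
  | succ m ih =>
    rcases lt_or_ge x (t m) with h | h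
    · obtain ⟨i, hi, h'⟩ := ih h
      exact ⟨i, hi.trans (Nat.lt_succ_self m), h'⟩
    · exact ⟨m, Nat.lt_succ_self m, h, hm⟩

theorem PiecewiseC1.contourIntegral_eq_sub {a b : ℂ} {γ : Path a b} (hγ : PiecewiseC1 γ)
    {f F : ℂ → ℂ} (hf : ContinuousOn f (range γ)) (hF : ∀ z ∈ range γ, HasDerivAt F (f z) z) :
    contourIntegral γ f = F b - F a := by
  have hint := hγ.contourIntegrable hf
  obtain ⟨m, t, ht, h0, h1, hC⟩ := hγ
  have hmem : ∀ x, γ.extend x ∈ range γ := fun x => by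
    rw [← γ.extend_range]; exact mem_range_self x
  rw [contourIntegral, curveIntegral_def]
  have := MeasureTheory.integral_eq_of_hasDerivAt_off_countable_of_le (fun x => F (γ.extend x))
    (curveIntegralFun (fun z : ℂ => f z • ContinuousLinearMap.id ℂ ℂ) γ) zero_le_one
    (countable_range t) ?_ ?_ hint
  · rw [this]; simp
  · intro x _
    exact (((hF _ (hmem x)).continuousAt).comp γ.continuous_extend.continuousAt).continuousWithinAt
  · rintro x ⟨hx, hxt⟩
    obtain ⟨i, hi, h2, h3⟩ := exists_mem_Ico_of_lt t x (h0 ▸ hx.1.le) m (h1 ▸ hx.2)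
    have h4 : t i < x := lt_of_le_of_ne h2 fun h => hxt ⟨i, h⟩
    have hd : DifferentiableAt ℝ γ.extend x :=
      ((hC i hi).differentiableOn one_ne_zero).differentiableAt (Icc_mem_nhds h4 h3)
    rw [curveIntegralFun_smul_id, derivWithin_of_mem_nhds (Icc_mem_nhds hx.1 hx.2), mul_comm]
    exact (hF _ (hmem x)).scomp x hd.hasDerivAt

theorem contourIntegral_congr {a b : ℂ} {γ : Path a b} {f g : ℂ → ℂ}
    (h : ∀ z ∈ range γ, f z = g z) : contourIntegral γ f = contourIntegral γ g := by
  rw [contourIntegral, contourIntegral, curveIntegral_def, curveIntegral_def]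
  congr 1; ext t
  rw [curveIntegralFun_smul_id, curveIntegralFun_smul_id, h]
  rw [← γ.extend_range]; exact mem_range_self t

theorem contourIntegral_add {a b : ℂ} {γ : Path a b} {f g : ℂ → ℂ}
    (hf : ContourIntegrable γ f) (hg : ContourIntegrable γ g) :
    contourIntegral γ (fun z => f z + g z) = contourIntegral γ f + contourIntegral γ g := by
  have h := curveIntegral_fun_add hf hg
  simp only [← add_smul] at h
  exact h

theorem contourIntegral_const_mul {a b : ℂ} {γ : Path a b} (c : ℂ) (f : ℂ → ℂ) :
    contourIntegral γ (fun z => c * f z) = c * contourIntegral γ f := by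
  rw [contourIntegral, contourIntegral, curveIntegral_def, curveIntegral_def,
    ← intervalIntegral.integral_const_mul]
  congr 1; ext t
  rw [curveIntegralFun_smul_id, curveIntegralFun_smul_id, mul_assoc]

theorem contourIntegral_sum {a b : ℂ} {γ : Path a b} {ι : Type*} (s : Finset ι) {f : ι → ℂ → ℂ}
    (hγ : PiecewiseC1 γ) (hf : ∀ i ∈ s, ContinuousOn (f i) (range γ)) :
    contourIntegral γ (fun z => ∑ i ∈ s, f i z) = ∑ i ∈ s, contourIntegral γ (f i) := by
  classical
  induction s using Finset.induction_on with
  | empty => simp [contourIntegral]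
  | insert i s hi ih =>
    simp only [Finset.sum_insert hi]
    have h1 : ∀ j ∈ s, ContinuousOn (f j) (range γ) := fun j hj =>
      hf j (Finset.mem_insert_of_mem hj)
    rw [contourIntegral_add (hγ.contourIntegrable (hf i (Finset.mem_insert_self i s)))
      (hγ.contourIntegrable (continuousOn_finsetSum s h1)), ih h1]

/-! ### Integrals over boundaries of rectangles and contour independence -/

/-- The integral of `f(z) dz` over the positively oriented boundary of `[a, b] × [c, d]`. -/
def rectIntegral (f : ℂ → ℂ) (a b c d : ℝ) : ℂ :=
  (∫ x : ℝ in a..b, f (x + c * Complex.I)) - (∫ x : ℝ in a..b, f (x + d * Complex.I)) +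
    Complex.I • (∫ y : ℝ in c..d, f (b + y * Complex.I)) -
    Complex.I • ∫ y : ℝ in c..d, f (a + y * Complex.I)

/-- The boundary of the rectangle `[a, b] × [c, d]`. -/
def rectBoundary (a b c d : ℝ) : Set ℂ :=
  {z | (z.re ∈ Icc a b ∧ (z.im = c ∨ z.im = d)) ∨ (z.im ∈ Icc c d ∧ (z.re = a ∨ z.re = b))}

theorem intervalIntegrable_horizontal {f : ℂ → ℂ} {a b c : ℝ} (hab : a ≤ b)
    (hf : ContinuousOn f {z | z.re ∈ Icc a b ∧ z.im = c}) :
    IntervalIntegrable (fun x : ℝ => f (x + c * Complex.I)) volume a b := by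
  refine ContinuousOn.intervalIntegrable_of_Icc hab (hf.comp (by fun_prop) fun x hx => ?_)
  simpa using hx

theorem intervalIntegrable_vertical {f : ℂ → ℂ} {a c d : ℝ} (hcd : c ≤ d)
    (hf : ContinuousOn f {z | z.im ∈ Icc c d ∧ z.re = a}) :
    IntervalIntegrable (fun y : ℝ => f (a + y * Complex.I)) volume c d := by
  refine ContinuousOn.intervalIntegrable_of_Icc hcd (hf.comp (by fun_prop) fun x hx => ?_)
  simpa using hx

theorem integral_horizontal_eq_sub {f F : ℂ → ℂ} {a b c : ℝ} (hab : a ≤ b)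
    (hf : ContinuousOn f {z | z.re ∈ Icc a b ∧ z.im = c})
    (hF : ∀ x ∈ Icc a b, HasDerivAt F (f (x + c * Complex.I)) (x + c * Complex.I)) :
    ∫ x : ℝ in a..b, f (x + c * Complex.I) = F (b + c * Complex.I) - F (a + c * Complex.I) := by
  refine intervalIntegral.integral_eq_sub_of_hasDerivAt
    (f := fun x : ℝ => F (x + c * Complex.I)) (fun x hx => ?_) ?_
  · rw [uIcc_of_le hab] at hx
    have h1 : HasDerivAt (fun x : ℝ => (x : ℂ) + c * Complex.I) 1 x :=
      (Complex.ofRealCLM.hasDerivAt (x := x)).add_const _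
    simpa [Function.comp_def] using (hF x hx).scomp x h1
  · exact intervalIntegrable_horizontal hab hf

theorem integral_vertical_eq_sub {f F : ℂ → ℂ} {a c d : ℝ} (hcd : c ≤ d)
    (hf : ContinuousOn f {z | z.im ∈ Icc c d ∧ z.re = a})
    (hF : ∀ y ∈ Icc c d, HasDerivAt F (f (a + y * Complex.I)) (a + y * Complex.I)) :
    Complex.I • ∫ y : ℝ in c..d, f (a + y * Complex.I) =
      F (a + d * Complex.I) - F (a + c * Complex.I) := by
  rw [← intervalIntegral.integral_smul]
  refine intervalIntegral.integral_eq_sub_of_hasDerivAt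
    (f := fun y : ℝ => F (a + y * Complex.I)) (fun y hy => ?_) ?_
  · rw [uIcc_of_le hcd] at hy
    have h1 : HasDerivAt (fun y : ℝ => (a : ℂ) + y * Complex.I) Complex.I y := by
      simpa using ((Complex.ofRealCLM.hasDerivAt (x := y)).mul_const Complex.I).const_add (a : ℂ)
    simpa [Function.comp_def] using (hF y hy).scomp y h1
  · simpa only [smul_eq_mul] using (intervalIntegrable_vertical hcd hf).const_mul Complex.I

section boundary

variable {f g : ℂ → ℂ} {a b c d : ℝ}

theorem continuousOn_bottom (hf : ContinuousOn f (rectBoundary a b c d)) :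
    ContinuousOn f {z | z.re ∈ Icc a b ∧ z.im = c} :=
  hf.mono fun _ hz => Or.inl ⟨hz.1, Or.inl hz.2⟩

theorem continuousOn_top (hf : ContinuousOn f (rectBoundary a b c d)) :
    ContinuousOn f {z | z.re ∈ Icc a b ∧ z.im = d} :=
  hf.mono fun _ hz => Or.inl ⟨hz.1, Or.inr hz.2⟩

theorem continuousOn_left (hf : ContinuousOn f (rectBoundary a b c d)) :
    ContinuousOn f {z | z.im ∈ Icc c d ∧ z.re = a} :=
  hf.mono fun _ hz => Or.inr ⟨hz.1, Or.inl hz.2⟩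

theorem continuousOn_right (hf : ContinuousOn f (rectBoundary a b c d)) :
    ContinuousOn f {z | z.im ∈ Icc c d ∧ z.re = b} :=
  hf.mono fun _ hz => Or.inr ⟨hz.1, Or.inr hz.2⟩

theorem rectIntegral_sub (hab : a ≤ b) (hcd : c ≤ d) (hf : ContinuousOn f (rectBoundary a b c d))
    (hg : ContinuousOn g (rectBoundary a b c d)) :
    rectIntegral (fun z => f z - g z) a b c d =
      rectIntegral f a b c d - rectIntegral g a b c d := by
  simp only [rectIntegral]
  rw [intervalIntegral.integral_sub (intervalIntegrable_horizontal hab (continuousOn_bottom hf))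
      (intervalIntegrable_horizontal hab (continuousOn_bottom hg)),
    intervalIntegral.integral_sub (intervalIntegrable_horizontal hab (continuousOn_top hf))
      (intervalIntegrable_horizontal hab (continuousOn_top hg)),
    intervalIntegral.integral_sub (intervalIntegrable_vertical hcd (continuousOn_left hf))
      (intervalIntegrable_vertical hcd (continuousOn_left hg)),
    intervalIntegral.integral_sub (intervalIntegrable_vertical hcd (continuousOn_right hf))
      (intervalIntegrable_vertical hcd (continuousOn_right hg))]
  simp only [smul_eq_mul]
  ring

theorem rectIntegral_const_mul (r : ℂ) (f : ℂ → ℂ) :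
    rectIntegral (fun z => r * f z) a b c d = r * rectIntegral f a b c d := by
  simp only [rectIntegral, intervalIntegral.integral_const_mul, smul_eq_mul]
  ring

theorem rectIntegral_congr (hab : a ≤ b) (hcd : c ≤ d)
    (h : ∀ z ∈ rectBoundary a b c d, f z = g z) :
    rectIntegral f a b c d = rectIntegral g a b c d := by
  simp only [rectIntegral]
  congr 1
  · congr 1
    · congr 1 <;>
      · refine intervalIntegral.integral_congr fun x hx => h _ (Or.inl ?_)
        rw [uIcc_of_le hab] at hx
        simpa using hx
    · congr 1
      refine intervalIntegral.integral_congr fun x hx => h _ (Or.inr ?_)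
      rw [uIcc_of_le hcd] at hx
      simpa using hx
  · congr 1
    refine intervalIntegral.integral_congr fun x hx => h _ (Or.inr ?_)
    rw [uIcc_of_le hcd] at hx
    simpa using hx

end boundary

/-- The plane cut along `(-∞, l]` and `[0, r]`. -/
def cutPlane (l r : ℝ) : Set ℂ :=
  {z | z.im ≠ 0 ∨ r < z.re ∨ (l < z.re ∧ z.re < 0)}

theorem rectBoundary_subset_cutPlane {l r : ℝ} (hl : l < 0) :
    rectBoundary (l / 2) (r + 1) (-1) 1 ⊆ cutPlane l r := by
  rintro z (⟨-, h | h⟩ | ⟨-, h | h⟩)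
  · exact Or.inl (by rw [h]; norm_num)
  · exact Or.inl (by rw [h]; norm_num)
  · exact Or.inr (Or.inr (by rw [h]; constructor <;> linarith))
  · exact Or.inr (Or.inl (by rw [h]; linarith))

theorem exists_hasDerivAt_of_convex {f : ℂ → ℂ} {s : Set ℂ} (hs : Convex ℝ s) (ho : IsOpen s)
    (hf : DifferentiableOn ℂ f s) : ∃ F : ℂ → ℂ, ∀ z ∈ s, HasDerivAt F (f z) z := by
  obtain ⟨F, hF⟩ := hs.exists_forall_hasDerivWithinAt hf
  exact ⟨F, fun z hz => (hF z hz).hasDerivAt (ho.mem_nhds hz)⟩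

theorem exists_eq_add_const_of_convex {f F G : ℂ → ℂ} {s : Set ℂ} (hs : Convex ℝ s)
    (ho : IsOpen s) (hF : ∀ z ∈ s, HasDerivAt F (f z) z) (hG : ∀ z ∈ s, HasDerivAt G (f z) z) :
    ∃ r : ℂ, ∀ z ∈ s, F z = G z + r := by
  obtain ⟨r, hr⟩ := ho.exists_eq_add_of_deriv_eq hs.isPreconnected
    (fun z hz => (hF z hz).differentiableAt.differentiableWithinAt)
    (fun z hz => (hG z hz).differentiableAt.differentiableWithinAt)
    (fun z hz => (hF z hz).deriv.trans (hG z hz).deriv.symm)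
  exact ⟨r, hr⟩

theorem convex_im_gt (r : ℝ) : Convex ℝ {z : ℂ | r < z.im} :=
  convex_halfSpace_gt Complex.imLm.isLinear r
theorem convex_im_lt (r : ℝ) : Convex ℝ {z : ℂ | z.im < r} :=
  convex_halfSpace_lt Complex.imLm.isLinear r
theorem convex_re_gt (r : ℝ) : Convex ℝ {z : ℂ | r < z.re} :=
  convex_halfSpace_gt Complex.reLm.isLinear r
theorem convex_re_lt (r : ℝ) : Convex ℝ {z : ℂ | z.re < r} :=
  convex_halfSpace_lt Complex.reLm.isLinear r
theorem isOpen_im_gt (r : ℝ) : IsOpen {z : ℂ | r < z.im} :=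
  isOpen_lt continuous_const Complex.continuous_im
theorem isOpen_im_lt (r : ℝ) : IsOpen {z : ℂ | z.im < r} :=
  isOpen_lt Complex.continuous_im continuous_const
theorem isOpen_re_gt (r : ℝ) : IsOpen {z : ℂ | r < z.re} :=
  isOpen_lt continuous_const Complex.continuous_re
theorem isOpen_re_lt (r : ℝ) : IsOpen {z : ℂ | z.re < r} :=
  isOpen_lt Complex.continuous_re continuous_const

/-- A holomorphic function on the doubly cut plane whose integral around one of the cuts vanishes
has a primitive. -/
theorem exists_primitive_cutPlane {l r : ℝ} (hl : l < 0) (hr : 0 < r) {f : ℂ → ℂ}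
    (hf : DifferentiableOn ℂ f (cutPlane l r))
    (h0 : rectIntegral f (l / 2) (r + 1) (-1) 1 = 0) :
    ∃ F : ℂ → ℂ, ∀ z ∈ cutPlane l r, HasDerivAt F (f z) z := by
  have cU := convex_im_gt 0
  have cL := convex_im_lt 0
  have cR := convex_re_gt r
  have cM := (convex_re_gt l).inter (convex_re_lt 0)
  have oU := isOpen_im_gt 0
  have oL := isOpen_im_lt 0
  have oR := isOpen_re_gt r
  have oM := (isOpen_re_gt l).inter (isOpen_re_lt 0)
  -- Four convex open sets cover the cut plane: upper and lower half-planes, the half-plane right of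
  -- `r`, and the strip between the cuts. Their overlaps are convex, so primitives differ there by
  -- constants.
  obtain ⟨U, hU⟩ := exists_hasDerivAt_of_convex cU oU (hf.mono fun z hz => Or.inl (ne_of_gt hz))
  obtain ⟨D, hD⟩ := exists_hasDerivAt_of_convex cL oL (hf.mono fun z hz => Or.inl (ne_of_lt hz))
  obtain ⟨R, hR⟩ := exists_hasDerivAt_of_convex cR oR (hf.mono fun z hz => Or.inr (Or.inl hz))
  obtain ⟨M, hM⟩ := exists_hasDerivAt_of_convex cM oM (hf.mono fun z hz => Or.inr (Or.inr hz))
  obtain ⟨ru, hru⟩ := exists_eq_add_const_of_convex (cU.inter cR) (oU.inter oR)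
    (fun z hz => hR z hz.2) (fun z hz => hU z hz.1)
  obtain ⟨rd, hrd⟩ := exists_eq_add_const_of_convex (cL.inter cR) (oL.inter oR)
    (fun z hz => hR z hz.2) (fun z hz => hD z hz.1)
  obtain ⟨mu, hmu⟩ := exists_eq_add_const_of_convex (cU.inter cM) (oU.inter oM)
    (fun z hz => hM z hz.2) (fun z hz => hU z hz.1)
  obtain ⟨md, hmd⟩ := exists_eq_add_const_of_convex (cL.inter cM) (oL.inter oM)
    (fun z hz => hM z hz.2) (fun z hz => hD z hz.1)
  -- Each side of the rectangle lies in one of the four sets. Evaluating the integral by the four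
  -- primitives leaves only the corner mismatches: the vanishing integral says that the jump from
  -- lower to upper half-plane is the same on either side of `[0, r]`.
  have key : ru - rd = mu - md := by
    have hc := hf.continuousOn.mono (rectBoundary_subset_cutPlane (r := r) hl)
    rw [rectIntegral, integral_horizontal_eq_sub (F := D) (by linarith)
        (continuousOn_bottom hc) (fun x _ => hD _ (by simp)),
      integral_horizontal_eq_sub (F := U) (by linarith)
        (continuousOn_top hc) (fun x _ => hU _ (by simp)),
      integral_vertical_eq_sub (F := R) (by linarith)
        (continuousOn_right hc) (fun x _ => hR _ (by simp)),
      integral_vertical_eq_sub (F := M) (by linarith)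
        (continuousOn_left hc) (fun x _ => hM _ (by constructor <;> simp <;> linarith)),
      hru _ (by constructor <;> simp), hrd _ (by constructor <;> simp),
      hmu _ (by refine ⟨?_, ?_, ?_⟩ <;> simp <;> linarith),
      hmd _ (by refine ⟨?_, ?_, ?_⟩ <;> simp <;> linarith)] at h0
    linear_combination h0
  classical
  let F : ℂ → ℂ := fun z => if 0 < z.im then U z + ru else if z.im < 0 then D z + rd else
    if r < z.re then R z else M z - mu + ru
  have FU : ∀ z ∈ {z : ℂ | 0 < z.im}, F z = U z + ru := fun z hz => if_pos hz
  have FD : ∀ z ∈ {z : ℂ | z.im < 0}, F z = D z + rd := fun z hz => by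
    have h1 : ¬ 0 < z.im := not_lt.2 (le_of_lt hz)
    simp only [F, if_neg h1]; exact if_pos hz
  have FR : ∀ z ∈ {z : ℂ | r < z.re}, F z = R z := fun z hz => by
    rcases lt_trichotomy 0 z.im with h | h | h
    · rw [FU z h, hru z ⟨h, hz⟩]
    · simp only [F, ← h, lt_irrefl, if_false]; exact if_pos hz
    · rw [FD z h, hrd z ⟨h, hz⟩]
  have FM : ∀ z ∈ {z : ℂ | l < z.re} ∩ {z : ℂ | z.re < 0}, F z = M z - mu + ru := fun z hz => by
    rcases lt_trichotomy 0 z.im with h | h | h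
    · rw [FU z h, hmu z ⟨h, hz⟩]; ring
    · have h1 : ¬ r < z.re := not_lt.2 ((le_of_lt hz.2).trans hr.le)
      simp only [F, ← h, lt_irrefl, if_false, if_neg h1]
    · rw [FD z h, hmd z ⟨h, hz⟩]; linear_combination -key
  refine ⟨F, fun z hz => ?_⟩
  have glue : ∀ {s : Set ℂ} {G : ℂ → ℂ}, IsOpen s → z ∈ s → (∀ u ∈ s, F u = G u) →
      HasDerivAt G (f z) z → HasDerivAt F (f z) z := fun ho hzs he hG =>
    hG.congr_of_eventuallyEq (Filter.eventually_of_mem (ho.mem_nhds hzs) he)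
  rcases hz with h | h | h
  · rcases lt_or_gt_of_ne h with h | h
    · exact glue oL h FD ((hD z h).add_const _)
    · exact glue oU h FU ((hU z h).add_const _)
  · exact glue oR h FR (hR z h)
  · exact glue oM h FM (((hM z h).sub_const _).add_const _)

/-- The principal logarithm is a primitive on three sides; on the left side `log (-z)` replaces it.
The mismatches `πi` and `-πi` at the two left corners combine to `2πi`. -/
theorem rectIntegral_inv {l r : ℝ} (hl : l < 0) (hr : 0 < r) :
    rectIntegral (fun z => z⁻¹) (l / 2) (r + 1) (-1) 1 = 2 * Real.pi * Complex.I := by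
  have hc : ContinuousOn (fun z : ℂ => z⁻¹) (rectBoundary (l / 2) (r + 1) (-1) 1) := by
    refine continuousOn_inv₀.mono fun z hz h => ?_
    have := rectBoundary_subset_cutPlane hl hz
    simp only [mem_singleton_iff] at h
    rw [h] at this
    simp [cutPlane] at this
    linarith
  have hlog : ∀ z : ℂ, (0 < z.re ∨ z.im ≠ 0) → HasDerivAt Complex.log z⁻¹ z :=
    fun z hz => Complex.hasDerivAt_log hz
  have hlog' : ∀ z : ℂ, z.re < 0 → HasDerivAt (fun z => Complex.log (-z)) z⁻¹ z := fun z hz => by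
    have h1 : -z ∈ Complex.slitPlane := Or.inl (by simpa using hz)
    have h2 := (hasDerivAt_neg z).clog h1
    convert h2 using 1
    rw [neg_div_neg_eq, one_div]
  rw [rectIntegral, integral_horizontal_eq_sub (F := Complex.log) (by linarith)
      (continuousOn_bottom hc) (fun x _ => hlog _ (Or.inr (by simp))),
    integral_horizontal_eq_sub (F := Complex.log) (by linarith)
      (continuousOn_top hc) (fun x _ => hlog _ (Or.inr (by simp))),
    integral_vertical_eq_sub (F := Complex.log) (by linarith)
      (continuousOn_right hc) (fun x _ => hlog _ (Or.inl (by simp; linarith))),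
    integral_vertical_eq_sub (F := fun z => Complex.log (-z)) (by linarith)
      (continuousOn_left hc) (fun x _ => hlog' _ (by simp; linarith))]
  have e1 : ∀ z : ℂ, 0 < z.im → Complex.log z - Complex.log (-z) = Real.pi * Complex.I :=
    fun z hz => by
      simp only [Complex.log, norm_neg, Complex.arg_neg_eq_arg_sub_pi_of_im_pos hz]
      push_cast; ring
  have e2 : ∀ z : ℂ, z.im < 0 → Complex.log z - Complex.log (-z) = -(Real.pi * Complex.I) :=
    fun z hz => by
      simp only [Complex.log, norm_neg, Complex.arg_neg_eq_arg_add_pi_of_im_neg hz]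
      push_cast; ring
  have h1 := e1 (((l / 2 : ℝ) : ℂ) + (1 : ℝ) * Complex.I) (by simp)
  have h2 := e2 (((l / 2 : ℝ) : ℂ) + (-1 : ℝ) * Complex.I) (by simp)
  linear_combination h1 - h2

theorem IsAdmissibleContour.range_subset_cutPlane {w : ℝ} {a : ℂ} {γ : Path a a}
    (hγ : IsAdmissibleContour w γ) : range γ ⊆ cutPlane (-1 / w) w := by
  intro z hz
  by_contra hc
  simp only [cutPlane, mem_ofPred_eq, not_or, not_not, not_and, not_lt] at hc
  obtain ⟨h1, h2, h3⟩ := hc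
  have hz' : z = (z.re : ℂ) := by apply Complex.ext <;> simp [h1]
  rcases le_or_gt z.re (-1 / w) with h | h
  · exact (hz' ▸ hγ.exterior z.re h : z ∈ exteriorOf γ).1 hz
  · exact (hz' ▸ hγ.interior z.re (h3 h) h2 : z ∈ interiorOf γ).1 hz

theorem ne_zero_of_mem_cutPlane {l r : ℝ} (hr : 0 < r) {z : ℂ} (hz : z ∈ cutPlane l r) :
    z ≠ 0 := by
  rintro rfl
  rcases hz with h | h | h
  · exact h rfl
  · exact absurd h (not_lt.2 hr.le)
  · exact lt_irrefl _ h.2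

/-- The integral of a function that is holomorphic off the two cuts is the same over all admissible
contours and over the boundary of a fixed rectangle. -/
theorem IsAdmissibleContour.contourIntegral_eq_rectIntegral {w : ℝ} (hw : 0 < w) {a : ℂ}
    {γ : Path a a} (hγ : IsAdmissibleContour w γ) {f : ℂ → ℂ}
    (hf : DifferentiableOn ℂ f (cutPlane (-1 / w) w)) :
    contourIntegral γ f = rectIntegral f (-1 / w / 2) (w + 1) (-1) 1 := by
  have hl : -1 / w < 0 := div_neg_of_neg_of_pos (by norm_num) hw
  have hpi : (2 * Real.pi * Complex.I : ℂ) ≠ 0 := Complex.two_pi_I_ne_zero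
  set J := rectIntegral f (-1 / w / 2) (w + 1) (-1) 1 with hJ
  -- The coefficient for which `f - D/z` has zero integral around the rectangle, hence a primitive
  -- on the cut plane.
  set D : ℂ := J / (2 * Real.pi * Complex.I) with hD
  have hinv : DifferentiableOn ℂ (fun z : ℂ => D * z⁻¹) (cutPlane (-1 / w) w) := fun z hz =>
    ((differentiableAt_inv (ne_zero_of_mem_cutPlane hw hz)).const_mul D).differentiableWithinAt
  have hsub := rectBoundary_subset_cutPlane (r := w) hl
  obtain ⟨F, hF⟩ := exists_primitive_cutPlane hl hw (hf.sub hinv) (by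
    change rectIntegral (fun z => f z - D * z⁻¹) _ _ _ _ = 0
    rw [rectIntegral_sub (by linarith) (by norm_num) (hf.continuousOn.mono hsub)
      (hinv.continuousOn.mono hsub), rectIntegral_const_mul, rectIntegral_inv hl hw, ← hJ, hD]
    field_simp
    ring)
  have hr := hγ.range_subset_cutPlane
  have hc : ContinuousOn (fun z => f z - D * z⁻¹) (range γ) :=
    (hf.sub hinv).continuousOn.mono hr
  have h0 := hγ.piecewiseC1.contourIntegral_eq_sub hc (fun z hz => hF z (hr hz))
  have h1 : contourIntegral γ (fun z => z⁻¹) = 2 * Real.pi * Complex.I := by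
    have := hγ.positive 0 (by simpa using hγ.interior 0 le_rfl hw.le)
    rw [windingNumber, inv_mul_eq_one₀ hpi] at this
    simpa using this.symm
  have h2 : contourIntegral γ f =
      contourIntegral γ (fun z => (f z - D * z⁻¹) + D * z⁻¹) :=
    contourIntegral_congr fun z _ => by ring
  rw [h2, contourIntegral_add (hγ.piecewiseC1.contourIntegrable hc)
    (hγ.piecewiseC1.contourIntegrable (hinv.continuousOn.mono hr)), contourIntegral_const_mul, h0,
    h1, hD, div_mul_cancel₀ _ hpi]
  ring

/-! ### An Euler integral -/

theorem hasDerivAt_intervalIntegral_of_continuousOn {U : Set ℂ} (hU : IsOpen U)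
    {G G' : ℂ → ℝ → ℂ} (hG : ContinuousOn (Function.uncurry G) (U ×ˢ Icc (0 : ℝ) 1))
    (hG' : ContinuousOn (Function.uncurry G') (U ×ˢ Icc (0 : ℝ) 1))
    (hd : ∀ s ∈ U, ∀ y ∈ Icc (0 : ℝ) 1, HasDerivAt (fun s => G s y) (G' s y) s)
    {s : ℂ} (hs : s ∈ U) :
    HasDerivAt (fun s => ∫ y in (0 : ℝ)..1, G s y) (∫ y in (0 : ℝ)..1, G' s y) s := by
  obtain ⟨r, hr, hrU⟩ := Metric.nhds_basis_closedBall.mem_iff.1 (hU.mem_nhds hs)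
  have hK : IsCompact (Metric.closedBall s r ×ˢ Icc (0 : ℝ) 1) :=
    (isCompact_closedBall s r).prod isCompact_Icc
  obtain ⟨C, hC⟩ := hK.exists_bound_of_continuousOn (hG'.mono (prod_mono hrU subset_rfl))
  have hslice : ∀ {H : ℂ → ℝ → ℂ}, ContinuousOn (Function.uncurry H) (U ×ˢ Icc (0 : ℝ) 1) →
      ∀ x ∈ U, IntervalIntegrable (H x) volume 0 1 := fun hH x hx =>
    ContinuousOn.intervalIntegrable_of_Icc zero_le_one
      (hH.comp (f := fun y : ℝ => (x, y)) (by fun_prop) fun y hy => ⟨hx, hy⟩)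
  have hI : Ι (0 : ℝ) 1 ⊆ Icc 0 1 := by rw [uIoc_of_le zero_le_one]; exact Ioc_subset_Icc_self
  refine (intervalIntegral.hasDerivAt_integral_of_dominated_loc_of_deriv_le
    (bound := fun _ => C) (Metric.closedBall_mem_nhds s hr) ?_ (hslice hG s hs)
    (intervalIntegrable_iff.1 (hslice hG' s hs)).aestronglyMeasurable ?_ intervalIntegrable_const ?_).2
  · filter_upwards [hU.mem_nhds hs] with x hx
    exact (intervalIntegrable_iff.1 (hslice hG x hx)).aestronglyMeasurable
  · exact Eventually.of_forall fun y hy x hx => hC (x, y) ⟨hx, hI hy⟩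
  · exact Eventually.of_forall fun y hy x hx => hd x (hrU hx) y (hI hy)

/-- The Euler integral `∫₀¹ x^(α - 1) (1 - s x)^β dx`, written in the variable `y = x^α`. -/
def eulerIntegral (α β : ℝ) (s : ℂ) : ℂ :=
  ∫ y in (0 : ℝ)..1, (α : ℂ)⁻¹ * (1 - s * (y ^ α⁻¹ : ℝ)) ^ (β : ℂ)

/-- The derivative of `eulerIntegral` with respect to its argument. -/
def eulerIntegralDeriv (α β : ℝ) (s : ℂ) : ℂ :=
  ∫ y in (0 : ℝ)..1, (α : ℂ)⁻¹ * ((β : ℂ) * (1 - s * (y ^ α⁻¹ : ℝ)) ^ ((β : ℂ) - 1) *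
    (-(y ^ α⁻¹ : ℝ)))

theorem one_sub_mul_mem_slitPlane {s : ℂ} (hs : 1 - s ∈ Complex.slitPlane) {x : ℝ}
    (hx : x ∈ Icc (0 : ℝ) 1) : 1 - s * x ∈ Complex.slitPlane := by
  have h := Complex.starConvex_one_slitPlane hs (sub_nonneg.2 hx.2) hx.1 (by ring)
  convert h using 1
  simp only [Complex.real_smul]
  push_cast
  ring

theorem rpow_mem_Icc {α : ℝ} (hα : 0 < α) {y : ℝ} (hy : y ∈ Icc (0 : ℝ) 1) :
    y ^ α⁻¹ ∈ Icc (0 : ℝ) 1 :=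
  ⟨Real.rpow_nonneg hy.1 _, Real.rpow_le_one hy.1 hy.2 (inv_nonneg.2 hα.le)⟩

theorem isOpen_one_sub_slitPlane : IsOpen {s : ℂ | 1 - s ∈ Complex.slitPlane} :=
  Complex.isOpen_slitPlane.preimage (by fun_prop)

/-- The variable `y = x^α` absorbs the endpoint singularity `x^(α-1)`: the integrand is continuous
on all of `[0, 1]` even for `α < 1`, so compactness suffices to differentiate under the integral. -/
theorem continuousOn_euler_cpow {α : ℝ} (hα : 0 < α) (c : ℂ) :
    ContinuousOn (fun p : ℂ × ℝ => (1 - p.1 * (p.2 ^ α⁻¹ : ℝ)) ^ c)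
      ({s : ℂ | 1 - s ∈ Complex.slitPlane} ×ˢ Icc (0 : ℝ) 1) := by
  refine ContinuousOn.cpow (Continuous.continuousOn ?_) continuousOn_const
    fun p hp => one_sub_mul_mem_slitPlane hp.1 (rpow_mem_Icc hα hp.2)
  have h := Real.continuous_rpow_const (inv_nonneg.2 hα.le)
  fun_prop

theorem hasDerivAt_eulerIntegral {α : ℝ} (hα : 0 < α) (β : ℝ) {s : ℂ}
    (hs : 1 - s ∈ Complex.slitPlane) :
    HasDerivAt (eulerIntegral α β) (eulerIntegralDeriv α β s) s := by
  have h := Real.continuous_rpow_const (inv_nonneg.2 hα.le)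
  refine hasDerivAt_intervalIntegral_of_continuousOn isOpen_one_sub_slitPlane
    (G := fun s y => (α : ℂ)⁻¹ * (1 - s * (y ^ α⁻¹ : ℝ)) ^ (β : ℂ))
    (G' := fun s y => (α : ℂ)⁻¹ * ((β : ℂ) * (1 - s * (y ^ α⁻¹ : ℝ)) ^ ((β : ℂ) - 1) *
      (-(y ^ α⁻¹ : ℝ))))
    (continuousOn_const.mul (continuousOn_euler_cpow hα _))
    (continuousOn_const.mul ((continuousOn_const.mul (continuousOn_euler_cpow hα _)).mul
      (Continuous.continuousOn (by fun_prop))))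
    (fun s hs y hy => ?_) hs
  have h1 : HasDerivAt (fun s : ℂ => 1 - s * (y ^ α⁻¹ : ℝ)) (-(y ^ α⁻¹ : ℝ)) s := by
    simpa using ((hasDerivAt_id s).mul_const ((y ^ α⁻¹ : ℝ) : ℂ)).const_sub 1
  exact (h1.cpow_const (one_sub_mul_mem_slitPlane hs (rpow_mem_Icc hα hy))).const_mul _

/-- The combined integrand is the `y`-derivative of `y (1 - s y^(1/α))^β`. Equivalently, `s^α` times
the Euler integral has derivative `s^(α-1) (1-s)^β`; the stated form involves no branch of `s^α`. -/
theorem eulerIntegral_ode {α : ℝ} (hα : 0 < α) (β : ℝ) {s : ℂ}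
    (hs : 1 - s ∈ Complex.slitPlane) :
    α * eulerIntegral α β s + s * eulerIntegralDeriv α β s = (1 - s) ^ (β : ℂ) := by
  have hcont := Real.continuous_rpow_const (inv_nonneg.2 hα.le)
  have hα' : (α : ℂ) ≠ 0 := by exact_mod_cast hα.ne'
  have hc : ∀ c : ℂ, ContinuousOn (fun y : ℝ => (1 - s * (y ^ α⁻¹ : ℝ)) ^ c) (Icc 0 1) :=
    fun c => (continuousOn_euler_cpow hα c).comp (f := fun y : ℝ => (s, y)) (by fun_prop)
      fun y hy => ⟨hs, hy⟩
  have hc1 : ContinuousOn (fun y : ℝ => (α : ℂ)⁻¹ * (1 - s * (y ^ α⁻¹ : ℝ)) ^ (β : ℂ)) (Icc 0 1) :=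
    continuousOn_const.mul (hc _)
  have hc2 : ContinuousOn (fun y : ℝ => (α : ℂ)⁻¹ * ((β : ℂ) *
      (1 - s * (y ^ α⁻¹ : ℝ)) ^ ((β : ℂ) - 1) * (-(y ^ α⁻¹ : ℝ)))) (Icc 0 1) :=
    continuousOn_const.mul ((continuousOn_const.mul (hc _)).mul
      (Continuous.continuousOn (by fun_prop)))
  have hi1 := (hc1.intervalIntegrable_of_Icc (μ := volume) zero_le_one).const_mul (α : ℂ)
  have hi2 := (hc2.intervalIntegrable_of_Icc (μ := volume) zero_le_one).const_mul s
  rw [eulerIntegral, eulerIntegralDeriv, ← intervalIntegral.integral_const_mul,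
    ← intervalIntegral.integral_const_mul, ← intervalIntegral.integral_add hi1 hi2,
    intervalIntegral.integral_eq_sub_of_hasDerivAt_of_le zero_le_one
      (f := fun y : ℝ => (y : ℂ) * (1 - s * (y ^ α⁻¹ : ℝ)) ^ (β : ℂ)) ?_ ?_ (hi1.add hi2)]
  · simp
  · exact (Continuous.continuousOn (by fun_prop)).mul (hc _)
  · intro y hy
    have h0 : HasDerivAt (fun y : ℝ => y ^ α⁻¹) (α⁻¹ * y ^ (α⁻¹ - 1)) y :=
      Real.hasDerivAt_rpow_const (Or.inl hy.1.ne')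
    have h1 : HasDerivAt (fun y : ℝ => 1 - s * ((y ^ α⁻¹ : ℝ) : ℂ))
        (-(s * (α⁻¹ * y ^ (α⁻¹ - 1) : ℝ))) y := (h0.ofReal_comp.const_mul s).const_sub 1
    have hm := one_sub_mul_mem_slitPlane hs (rpow_mem_Icc hα (Ioo_subset_Icc_self hy))
    have h2 := (Complex.hasStrictDerivAt_cpow_const (c := (β : ℂ)) hm).hasDerivAt.comp y h1
    have h3 := (Complex.ofRealCLM.hasDerivAt (x := y)).mul h2
    refine HasDerivAt.congr_deriv h3 ?_
    have e : y * y ^ (α⁻¹ - 1) = y ^ α⁻¹ := by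
      rw [Real.rpow_sub_one hy.1.ne']; field_simp [hy.1.ne']
    have e' : (y : ℂ) * ((y ^ (α⁻¹ - 1) : ℝ) : ℂ) = ((y ^ α⁻¹ : ℝ) : ℂ) := by exact_mod_cast e
    simp only [Complex.ofRealCLM_apply, Complex.ofReal_one, one_mul, Complex.ofReal_mul,
      Complex.ofReal_inv, Function.comp_apply]
    rw [← e']
    field_simp

theorem eulerIntegral_half_pos {α : ℝ} (hα : 0 < α) (β : ℝ) :
    ∃ x : ℝ, 0 < x ∧ eulerIntegral α β (1 / 2) = x := by
  have hpos : ∀ y ∈ Icc (0 : ℝ) 1, 0 < 1 - 1 / 2 * y ^ α⁻¹ := fun y hy => by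
    linarith [(rpow_mem_Icc hα hy).2]
  have hcont := Real.continuous_rpow_const (inv_nonneg.2 hα.le)
  refine ⟨∫ y in (0 : ℝ)..1, α⁻¹ * (1 - 1 / 2 * y ^ α⁻¹) ^ β, ?_, ?_⟩
  · refine intervalIntegral.intervalIntegral_pos_of_pos_on ?_ (fun y hy => ?_) zero_lt_one
    · refine ContinuousOn.intervalIntegrable_of_Icc zero_le_one (continuousOn_const.mul ?_)
      exact ContinuousOn.rpow_const (Continuous.continuousOn (by fun_prop))
        fun y hy => Or.inl (hpos y hy).ne'
    · exact mul_pos (inv_pos.2 hα) (Real.rpow_pos_of_pos (hpos y (Ioo_subset_Icc_self hy)) _)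
  · rw [eulerIntegral, ← intervalIntegral.integral_ofReal]
    refine intervalIntegral.integral_congr fun y hy => ?_
    rw [uIcc_of_le zero_le_one] at hy
    simp only [Complex.ofReal_mul, Complex.ofReal_inv, Complex.ofReal_cpow (hpos y hy).le]
    push_cast
    rfl

theorem isPreconnected_cut_unit :
    IsPreconnected {s : ℂ | s ∈ Complex.slitPlane ∧ 1 - s ∈ Complex.slitPlane} := by
  have h : StarConvex ℝ (1 / 2 : ℂ)
      {s : ℂ | s ∈ Complex.slitPlane ∧ 1 - s ∈ Complex.slitPlane} := by
    have hs : StarConvex ℝ (1 / 2 : ℂ) Complex.slitPlane := by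
      have := Complex.starConvex_ofReal_slitPlane (x := 1 / 2) (by norm_num)
      simpa using this
    rintro s ⟨h1, h2⟩ a b ha hb hab
    refine ⟨hs h1 ha hb hab, ?_⟩
    have h3 := hs h2 ha hb hab
    convert h3 using 1
    have hab' : (a : ℂ) + b = 1 := by exact_mod_cast hab
    simp only [Complex.real_smul]
    linear_combination -hab'
  exact (h.isPathConnected
    ⟨by norm_num [Complex.slitPlane], by norm_num [Complex.slitPlane]⟩).isConnected.isPreconnected

/-- The two incomplete Beta functions add up to the (nonzero) complete one. -/
theorem exists_eulerIntegral_connection {m e : ℝ} (hm : 0 < m) (he : 0 < e + 1) :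
    ∃ B : ℂ, B ≠ 0 ∧ ∀ s : ℂ, s ∈ Complex.slitPlane → 1 - s ∈ Complex.slitPlane →
      s ^ (m : ℂ) * eulerIntegral m e s +
        (1 - s) ^ ((e + 1 : ℝ) : ℂ) * eulerIntegral (e + 1) (m - 1) (1 - s) = B := by
  set V : Set ℂ := {s : ℂ | s ∈ Complex.slitPlane ∧ 1 - s ∈ Complex.slitPlane}
  set Φ : ℂ → ℂ := fun s => s ^ (m : ℂ) * eulerIntegral m e s +
        (1 - s) ^ ((e + 1 : ℝ) : ℂ) * eulerIntegral (e + 1) (m - 1) (1 - s)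
  have hV : IsOpen V := Complex.isOpen_slitPlane.inter isOpen_one_sub_slitPlane
  -- By the differential equation the two summands have derivatives `s^(m-1) (1-s)^e` and its
  -- negative.
  have hd : ∀ s ∈ V, HasDerivAt Φ 0 s := by
    rintro s ⟨h1, h2⟩
    have hs0 := Complex.slitPlane_ne_zero h1
    have hs1 := Complex.slitPlane_ne_zero h2
    have a1 := (Complex.hasStrictDerivAt_cpow_const (c := (m : ℂ)) h1).hasDerivAt.mul
      (hasDerivAt_eulerIntegral hm e h2)
    have hsub : HasDerivAt (fun s : ℂ => 1 - s) (-1) s := (hasDerivAt_id s).const_sub 1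
    have a2 := (hsub.cpow_const (c := ((e + 1 : ℝ) : ℂ)) h2).mul
      ((hasDerivAt_eulerIntegral he (m - 1) (s := 1 - s) (by simpa using h1)).comp s hsub)
    refine HasDerivAt.congr_deriv (f := Φ) (a1.add a2) ?_
    have o1 := eulerIntegral_ode hm e h2
    have o2 := eulerIntegral_ode he (m - 1) (s := 1 - s) (by simpa using h1)
    have p1 : s ^ (m : ℂ) = s ^ ((m : ℂ) - 1) * s := by
      rw [Complex.cpow_sub _ _ hs0, Complex.cpow_one, div_mul_cancel₀ _ hs0]
    have p2 : (1 - s) ^ ((e + 1 : ℝ) : ℂ) = (1 - s) ^ (e : ℂ) * (1 - s) := by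
      push_cast
      rw [Complex.cpow_add _ _ hs1, Complex.cpow_one]
    have p3 : ((e + 1 : ℝ) : ℂ) - 1 = e := by push_cast; ring
    rw [sub_sub_cancel] at o2
    have p4 : ((m - 1 : ℝ) : ℂ) = (m : ℂ) - 1 := by push_cast; ring
    rw [p4] at o2
    rw [p1, p2, p3]
    simp only [Function.comp_apply]
    linear_combination (s ^ ((m : ℂ) - 1)) * o1 - (1 - s) ^ (e : ℂ) * o2
  obtain ⟨B, hB⟩ := hV.exists_is_const_of_deriv_eq_zero isPreconnected_cut_unit
    (fun s hs => (hd s hs).differentiableAt.differentiableWithinAt) (fun s hs => (hd s hs).deriv)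
  refine ⟨B, ?_, fun s h1 h2 => hB s ⟨h1, h2⟩⟩
  -- At `s = 1/2` both summands are positive reals, so the constant is not zero.
  obtain ⟨x, hx, hx'⟩ := eulerIntegral_half_pos hm e
  obtain ⟨y, hy, hy'⟩ := eulerIntegral_half_pos he (m - 1)
  rw [← hB (1 / 2) ⟨by norm_num [Complex.slitPlane], by norm_num [Complex.slitPlane]⟩]
  have h12 : (1 : ℂ) - 1 / 2 = 1 / 2 := by norm_num
  have hr : ∀ c : ℝ, (1 / 2 : ℂ) ^ (c : ℂ) = (((1 / 2 : ℝ) ^ c : ℝ) : ℂ) := fun c => by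
    rw [Complex.ofReal_cpow (by norm_num)]; norm_num
  simp only [Φ]
  rw [h12, hx', hy', hr, hr]
  have : (0 : ℝ) < (1 / 2) ^ m * x + (1 / 2) ^ (e + 1) * y := by positivity
  exact_mod_cast this.ne'

/-! ### The `∂̄`-derivative and Stokes' theorem on rectangles -/

/-- `f` is real-differentiable at `z` with `∂f/∂z̄ = b`. -/
def HasDbarAt (f : ℂ → ℂ) (b z : ℂ) : Prop :=
  ∃ a : ℂ, HasFDerivAt (𝕜 := ℝ) f
    (a • (1 : ℂ →L[ℝ] ℂ) + b • (Complex.conjCLE : ℂ →L[ℝ] ℂ)) z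

namespace HasDbarAt

variable {f g : ℂ → ℂ} {b c z : ℂ}

theorem of_hasDerivAt {a : ℂ} (h : HasDerivAt f a z) : HasDbarAt f 0 z := by
  refine ⟨a, (h.hasFDerivAt.restrictScalars ℝ).congr_fderiv ?_⟩
  ext; simp [mul_comm]

theorem of_differentiableAt (h : DifferentiableAt ℂ f z) : HasDbarAt f 0 z :=
  of_hasDerivAt h.hasDerivAt

theorem conj_self (z : ℂ) : HasDbarAt (starRingEnd ℂ) 1 z :=
  ⟨0, (Complex.conjCLE : ℂ →L[ℝ] ℂ).hasFDerivAt.congr_fderiv (by simp)⟩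

theorem mul (hf : HasDbarAt f b z) (hg : HasDbarAt g c z) :
    HasDbarAt (fun z => f z * g z) (b * g z + f z * c) z := by
  obtain ⟨a, hf⟩ := hf
  obtain ⟨d, hg⟩ := hg
  refine ⟨a * g z + f z * d, (hf.mul hg).congr_fderiv ?_⟩
  ext; simp; ring

theorem comp {h : ℂ → ℂ} {h' : ℂ} (hh : HasDerivAt h h' (f z)) (hf : HasDbarAt f b z) :
    HasDbarAt (fun z => h (f z)) (h' * b) z := by
  obtain ⟨a, hf⟩ := hf
  refine ⟨h' * a, ((hh.hasFDerivAt.restrictScalars ℝ).comp z hf).congr_fderiv ?_⟩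
  ext; simp; ring

theorem add_const (hf : HasDbarAt f b z) (r : ℂ) : HasDbarAt (fun z => f z + r) b z := by
  simpa using hf.comp ((hasDerivAt_id (f z)).add_const r)

theorem const_add (hf : HasDbarAt f b z) (r : ℂ) : HasDbarAt (fun z => r + f z) b z := by
  simpa using hf.comp ((hasDerivAt_id (f z)).const_add r)

theorem neg (hf : HasDbarAt f b z) : HasDbarAt (fun z => -f z) (-b) z := by
  simpa using hf.comp (hasDerivAt_neg (f z))

theorem const_sub (hf : HasDbarAt f b z) (r : ℂ) : HasDbarAt (fun z => r - f z) (-b) z := by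
  simpa using hf.comp ((hasDerivAt_id (f z)).const_sub r)

theorem cpow_const (hf : HasDbarAt f b z) (h : f z ∈ Complex.slitPlane) (r : ℂ) :
    HasDbarAt (fun z => f z ^ r) (r * f z ^ (r - 1) * b) z :=
  hf.comp (Complex.hasStrictDerivAt_cpow_const (c := r) h).hasDerivAt

theorem pow (hf : HasDbarAt f b z) (n : ℕ) :
    HasDbarAt (fun z => f z ^ n) (n * f z ^ (n - 1) * b) z :=
  hf.comp (hasDerivAt_pow n (f z))

theorem congr_dbar (hf : HasDbarAt f b z) (h : b = c) : HasDbarAt f c z := h ▸ hf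

theorem continuousAt (hf : HasDbarAt f b z) : ContinuousAt f z := by
  obtain ⟨a, hf⟩ := hf
  exact hf.continuousAt

end HasDbarAt

/-- Stokes' theorem on a rectangle. -/
theorem rectIntegral_eq_integral_dbar {F f : ℂ → ℂ} {a b c d : ℝ} (hab : a ≤ b) (hcd : c ≤ d)
    {s : Set ℂ} (hs : s.Countable) (hF : ContinuousOn F (Icc a b ×ℂ Icc c d))
    (hd : ∀ z ∈ (Icc a b ×ℂ Icc c d) \ s, HasDbarAt F (f z) z) (hf : Continuous f) :
    rectIntegral F a b c d =
      2 * Complex.I * ∫ x : ℝ in a..b, ∫ y : ℝ in c..d, f (x + y * Complex.I) := by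
  classical
  -- The `∂/∂z` part is chosen pointwise, with the junk value `0` where there is none. It cancels
  -- from the Stokes integrand `i L(1) - L(i)`, so no regularity of `A` is needed.
  have h1 : ∀ z, ∃ A : ℂ, HasDbarAt F (f z) z → HasFDerivAt (𝕜 := ℝ) F
      (A • (1 : ℂ →L[ℝ] ℂ) + f z • (Complex.conjCLE : ℂ →L[ℝ] ℂ)) z := fun z => by
    by_cases h : HasDbarAt F (f z) z
    · exact ⟨h.choose, fun _ => h.choose_spec⟩
    · exact ⟨0, fun h' => absurd h' h⟩
  choose A hA using h1
  have key : ∀ z, Complex.I • (A z • (1 : ℂ →L[ℝ] ℂ) + f z • (Complex.conjCLE : ℂ →L[ℝ] ℂ)) 1 -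
      (A z • (1 : ℂ →L[ℝ] ℂ) + f z • (Complex.conjCLE : ℂ →L[ℝ] ℂ)) Complex.I =
        2 * Complex.I * f z := fun z => by
    simp; ring
  have hst := Complex.integral_boundary_rect_of_hasFDerivAt_real_off_countable F
    (fun z => A z • (1 : ℂ →L[ℝ] ℂ) + f z • (Complex.conjCLE : ℂ →L[ℝ] ℂ))
    ⟨a, c⟩ ⟨b, d⟩ s hs (by simpa only [uIcc_of_le hab, uIcc_of_le hcd] using hF)
    (fun z hz => hA z (hd z ⟨?_, hz.2⟩)) ?_
  · simp only [key, intervalIntegral.integral_const_mul] at hst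
    exact hst
  · have := hz.1
    simp only [min_eq_left hab, min_eq_left hcd, max_eq_right hab, max_eq_right hcd] at this
    exact ⟨Ioo_subset_Icc_self this.1, Ioo_subset_Icc_self this.2⟩
  · simp only [key]
    exact (Continuous.continuousOn (by fun_prop)).integrableOn_compact
      (isCompact_uIcc.reProdIm isCompact_uIcc)

/-! ### Two potentials of the planar integrand -/

/-- `1 + |z|²`, as a complex number. -/
def sphericalFactor (z : ℂ) : ℂ := 1 + z * conj z

theorem sphericalFactor_eq (z : ℂ) : sphericalFactor z = ((1 + ‖z‖ ^ 2 : ℝ) : ℂ) := by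
  rw [sphericalFactor, Complex.mul_conj']; push_cast; rfl

theorem one_add_norm_sq_pos (z : ℂ) : 0 < 1 + ‖z‖ ^ 2 := by positivity

theorem sphericalFactor_mem_slitPlane (z : ℂ) : sphericalFactor z ∈ Complex.slitPlane := by
  rw [sphericalFactor_eq]
  exact Complex.ofReal_mem_slitPlane.2 (one_add_norm_sq_pos z)

theorem sphericalFactor_ne_zero (z : ℂ) : sphericalFactor z ≠ 0 :=
  Complex.slitPlane_ne_zero (sphericalFactor_mem_slitPlane z)

theorem hasDbarAt_sphericalFactor (z : ℂ) : HasDbarAt sphericalFactor z z := by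
  have h := ((HasDbarAt.of_hasDerivAt (hasDerivAt_id z)).mul (HasDbarAt.conj_self z)).const_add 1
  exact h.congr_dbar (by simp)

/-- `(1 + z w) / (1 + |z|²)`. -/
def sphericalRatio (w : ℝ) (z : ℂ) : ℂ := (1 + z * w) * (sphericalFactor z)⁻¹

theorem one_sub_sphericalRatio (w : ℝ) (z : ℂ) :
    1 - sphericalRatio w z = z * (conj z - w) * (sphericalFactor z)⁻¹ := by
  have h := sphericalFactor_ne_zero z
  rw [sphericalRatio]
  field_simp
  rw [sphericalFactor]
  ring

theorem hasDbarAt_sphericalRatio (w : ℝ) (z : ℂ) :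
    HasDbarAt (sphericalRatio w) (-(sphericalRatio w z * z * (sphericalFactor z)⁻¹)) z := by
  have h := (HasDbarAt.of_differentiableAt (f := fun z : ℂ => 1 + z * w) (z := z)
    (by fun_prop)).mul ((hasDbarAt_sphericalFactor z).comp
      (hasDerivAt_inv (sphericalFactor_ne_zero z)))
  have e : -(sphericalRatio w z * z * (sphericalFactor z)⁻¹) =
      0 * (sphericalFactor z)⁻¹ + (1 + z * w) * (-(sphericalFactor z ^ 2)⁻¹ * z) := by
    rw [sphericalRatio]; field_simp; ring
  rw [e]
  exact h

/-- The planar integrand, written with complex powers. -/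
def planarDensity (w q m : ℝ) (k : ℕ) (P : Polynomial ℂ) (z : ℂ) : ℂ :=
  P.eval z * (conj z - w) ^ k * ((z - w) * (conj z - w)) ^ (q : ℂ) *
    sphericalFactor z ^ (-(m + k + q + 1) : ℂ)

/-- A `∂̄`-primitive of `planarDensity` that is regular off `(-∞, -1/w]`. -/
def innerPotential (w q m : ℝ) (k : ℕ) (P : Polynomial ℂ) (z : ℂ) : ℂ :=
  P.eval z * (conj z - w) ^ (k + 1) * ((z - w) * (conj z - w)) ^ (q : ℂ) *
    sphericalFactor z ^ (-(m + k + q + 1) : ℂ) *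
      (sphericalRatio w z ^ (-m : ℂ) *
        eulerIntegral (k + q + 1) (m - 1) (1 - sphericalRatio w z))

/-- A `∂̄`-primitive of `planarDensity` that is regular off `[0, w]` and small at infinity. -/
def outerPotential (w q m : ℝ) (k : ℕ) (P : Polynomial ℂ) (z : ℂ) : ℂ :=
  -(P.eval z * (1 - w / z) ^ (q : ℂ) * (z ^ (k + 1))⁻¹ *
    (sphericalFactor z ^ (-m : ℂ) * eulerIntegral m (k + q) (sphericalRatio w z)))

/-- The contour integrand. -/
def contourKernel (w q m : ℝ) (k : ℕ) (P : Polynomial ℂ) (z : ℂ) : ℂ :=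
  P.eval z * (1 - w / z) ^ (q : ℂ) * (z ^ (k + 1))⁻¹ * (1 + z * w) ^ (-m : ℂ)

theorem mul_conj_sub_eq (w : ℝ) (z : ℂ) :
    (z - w) * (conj z - w) = ((‖z - w‖ ^ 2 : ℝ) : ℂ) := by
  have h := Complex.mul_conj' (z - w)
  rw [map_sub, Complex.conj_ofReal] at h
  rw [h]; push_cast; rfl

theorem mul_conj_sub_mem_slitPlane {w : ℝ} {z : ℂ} (hz : z ≠ w) :
    (z - w) * (conj z - w) ∈ Complex.slitPlane := by
  rw [mul_conj_sub_eq]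
  exact Complex.ofReal_mem_slitPlane.2 (by have := norm_pos_iff.2 (sub_ne_zero.2 hz); positivity)

theorem cpow_sub_one_mul {x : ℂ} (hx : x ≠ 0) (r : ℂ) : x ^ (r - 1) * x = x ^ r := by
  rw [Complex.cpow_sub _ _ hx, Complex.cpow_one, div_mul_cancel₀ _ hx]

/-- With `v = z̄ - w` and `ρ = 1 + |z|²`, one has `v ∂̄ρ/ρ = 1 - s` and `v ∂̄s = -s(1 - s)`.
Dividing the derivative by the density therefore leaves `s^(1-m) (α E + (1-s) E')`, where `α = k + q
+ 1` and `E`, `E'` are taken at `1 - s`. This is `1` by the differential equation. -/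
theorem hasDbarAt_innerPotential {w q m : ℝ} (hq : 0 < q) {k : ℕ} (P : Polynomial ℂ) {z : ℂ}
    (hz : z ≠ w) (hs : sphericalRatio w z ∈ Complex.slitPlane) :
    HasDbarAt (innerPotential w q m k P) (planarDensity w q m k P z) z := by
  have hα : 0 < (k : ℝ) + q + 1 := by positivity
  have hv : HasDbarAt (fun z : ℂ => conj z - (w : ℂ)) 1 z := by
    simpa [sub_eq_add_neg] using (HasDbarAt.conj_self z).add_const (-(w : ℂ))
  have hS : HasDbarAt (fun z : ℂ => (z - w) * (conj z - w)) (z - w) z := by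
    simpa using (HasDbarAt.of_differentiableAt (f := fun z : ℂ => z - w) (by fun_prop)).mul hv
  have hP : HasDbarAt (fun z : ℂ => P.eval z) 0 z := HasDbarAt.of_differentiableAt P.differentiableAt
  have hσ := hasDbarAt_sphericalRatio w z
  have hs' : 1 - (1 - sphericalRatio w z) ∈ Complex.slitPlane := by simpa using hs
  have main := (((hP.mul (hv.pow (k + 1))).mul
    (hS.cpow_const (mul_conj_sub_mem_slitPlane hz) q)).mul
    ((hasDbarAt_sphericalFactor z).cpow_const (sphericalFactor_mem_slitPlane z)
      (-(m + k + q + 1) : ℂ))).mul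
    ((hσ.cpow_const hs (-m)).mul
      ((hσ.const_sub 1).comp (hasDerivAt_eulerIntegral hα (m - 1) hs')))
  have ode := eulerIntegral_ode hα (m - 1) hs'
  have hs0 := Complex.slitPlane_ne_zero hs
  have hS1 := cpow_sub_one_mul (Complex.slitPlane_ne_zero (mul_conj_sub_mem_slitPlane hz)) q
  have hR1 := cpow_sub_one_mul (sphericalFactor_ne_zero z) (-(m + k + q + 1) : ℂ)
  have hT1 := cpow_sub_one_mul hs0 (-m : ℂ)
  have hTX : sphericalRatio w z ^ (-m : ℂ) * sphericalRatio w z ^ ((m - 1 : ℝ) : ℂ) *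
      sphericalRatio w z = 1 := by
    rw [mul_assoc]
    push_cast
    rw [cpow_sub_one_mul hs0, ← Complex.cpow_add _ _ hs0, neg_add_cancel, Complex.cpow_zero]
  have hτ := one_sub_sphericalRatio w z
  have hρ := mul_inv_cancel₀ (sphericalFactor_ne_zero z)
  rw [sub_sub_cancel] at ode
  push_cast at ode hTX
  refine main.congr_dbar ?_
  clear main
  simp only [add_tsub_cancel_right, pow_succ, planarDensity]
  push_cast
  -- With the powers replaced by free symbols, only their multiplicative relations matter and the
  -- claim is a polynomial identity.
  generalize conj z - (w : ℂ) = v at *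
  generalize ((z - (w : ℂ)) * v) ^ ((q : ℂ) - 1) = A' at *
  generalize ((z - (w : ℂ)) * v) ^ (q : ℂ) = A at *
  generalize sphericalFactor z ^ (-(m + k + q + 1) - 1 : ℂ) = R' at *
  generalize sphericalFactor z ^ (-(m + k + q + 1) : ℂ) = R at *
  generalize (sphericalFactor z)⁻¹ = r at *
  generalize sphericalFactor z = t at *
  generalize eulerIntegralDeriv (k + q + 1) (m - 1) (1 - sphericalRatio w z) = E' at *
  generalize eulerIntegral (k + q + 1) (m - 1) (1 - sphericalRatio w z) = E at *
  generalize sphericalRatio w z ^ ((m : ℂ) - 1) = X at *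
  generalize sphericalRatio w z ^ (-m - 1 : ℂ) = T' at *
  generalize sphericalRatio w z ^ (-m : ℂ) = T at *
  generalize sphericalRatio w z = s at *
  generalize P.eval z = p at *
  have h2 : R' * z * v = R * (1 - s) := by
    rw [hτ, ← hR1]
    linear_combination -(R' * z * v) * hρ
  have h3 : v * -(s * z * r) = -(s * (1 - s)) := by rw [hτ]; ring
  linear_combination (q * p * v ^ k * R * T * E) * hS1 -
    ((m + k + q + 1) * p * v ^ k * A * T * E) * h2 +
    (p * v ^ k * A * R * (-m * T' * E - T * E')) * h3 + (p * v ^ k * A * R * m * (1 - s) * E) * hT1 +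
    (p * v ^ k * A * R * T * s) * ode + (p * v ^ k * A * R) * hTX

/-- Off the negative axis the logarithms of `u` and its conjugate are conjugate, so they add up to
`2 log ‖u‖` with no multiple of `2πi`. -/
theorem cpow_mul_conj_cpow {u : ℂ} (hu : u ∈ Complex.slitPlane) {r : ℝ} (hr : 0 < r) (q : ℝ) :
    u ^ (q : ℂ) * (r * conj u) ^ (q : ℂ) = (((r * ‖u‖ ^ 2) ^ q : ℝ) : ℂ) := by
  have hu0 := Complex.slitPlane_ne_zero hu
  have hc0 : conj u ≠ 0 := by simpa using hu0
  have hr0 : (r : ℂ) ≠ 0 := by exact_mod_cast hr.ne'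
  have hn : 0 < ‖u‖ := norm_pos_iff.2 hu0
  have hpos : 0 < r * ‖u‖ ^ 2 := by positivity
  have harg : u.arg ≠ Real.pi := Complex.slitPlane_arg_ne_pi hu
  rw [Complex.cpow_def_of_ne_zero hu0, Complex.cpow_def_of_ne_zero (mul_ne_zero hr0 hc0),
    Complex.log_ofReal_mul hr hc0, Complex.log_conj _ harg, ← Complex.exp_add, ← add_mul,
    Real.rpow_def_of_pos hpos, Complex.ofReal_exp]
  congr 1
  have h2 : Complex.log u + conj (Complex.log u) = 2 * Real.log ‖u‖ := by
    rw [Complex.add_conj, Complex.log_re]; push_cast; rfl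
  rw [Real.log_mul hr.ne' (by positivity), Real.log_pow]
  push_cast
  linear_combination (q : ℂ) * h2

/-- Being a positive multiple of the conjugate of `1 - w/z`, the number `1 - s` avoids the negative
axis whenever `1 - w/z` does, and their `q`-th powers multiply to a real power. -/
theorem one_sub_sphericalRatio_eq_mul_conj (w : ℝ) {z : ℂ} (hz : z ≠ 0) :
    1 - sphericalRatio w z = ((‖z‖ ^ 2 / (1 + ‖z‖ ^ 2) : ℝ) : ℂ) * conj (1 - w / z) := by
  have hz' : conj z ≠ 0 := by simpa using hz
  rw [one_sub_sphericalRatio, Complex.ofReal_div, ← sphericalFactor_eq, Complex.ofReal_pow,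
    ← Complex.mul_conj']
  have h := sphericalFactor_ne_zero z
  simp only [map_sub, map_one, map_div₀, Complex.conj_ofReal]
  field_simp

theorem real_mul_mem_slitPlane {r : ℝ} (hr : 0 < r) {u : ℂ} (hu : u ∈ Complex.slitPlane) :
    (r : ℂ) * u ∈ Complex.slitPlane := by
  rw [Complex.mem_slitPlane_iff] at hu ⊢
  rcases hu with h | h
  · left; simpa using mul_pos hr h
  · right; simpa using ⟨hr.ne', h⟩

theorem conj_mem_slitPlane {u : ℂ} (hu : u ∈ Complex.slitPlane) :
    conj u ∈ Complex.slitPlane := by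
  rw [Complex.mem_slitPlane_iff] at hu ⊢
  simpa using hu

theorem one_sub_sphericalRatio_mem_slitPlane {w : ℝ} {z : ℂ} (hz : z ≠ 0)
    (hu : 1 - w / z ∈ Complex.slitPlane) : 1 - sphericalRatio w z ∈ Complex.slitPlane := by
  rw [one_sub_sphericalRatio_eq_mul_conj w hz]
  have := norm_pos_iff.2 hz
  exact real_mul_mem_slitPlane (by positivity) (conj_mem_slitPlane hu)

theorem cpow_mul_one_sub_sphericalRatio_cpow {w : ℝ} {z : ℂ} (hz : z ≠ 0)
    (hu : 1 - w / z ∈ Complex.slitPlane) (q : ℝ) :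
    (1 - w / z) ^ (q : ℂ) * (1 - sphericalRatio w z) ^ (q : ℂ) =
      ((z - w) * (conj z - w)) ^ (q : ℂ) * sphericalFactor z ^ (-q : ℂ) := by
  have hzn := norm_pos_iff.2 hz
  have hρ := one_add_norm_sq_pos z
  rw [one_sub_sphericalRatio_eq_mul_conj w hz, cpow_mul_conj_cpow hu (by positivity),
    mul_conj_sub_eq, sphericalFactor_eq, ← Complex.ofReal_neg, ← Complex.ofReal_cpow (by positivity),
    ← Complex.ofReal_cpow hρ.le, ← Complex.ofReal_mul, Real.rpow_neg hρ.le, ← div_eq_mul_inv,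
    ← Real.div_rpow (by positivity) hρ.le]
  congr 2
  have h : z - w = z * (1 - w / z) := by field_simp
  rw [h, norm_mul]
  ring

/-- The prefactor is holomorphic, so `∂̄` only meets `ρ^(-m) E(s)`, where `ρ = 1 + |z|²`. It gives
`-z ρ^(-m-1) (m E + s E')`, which the differential equation turns into `-z ρ^(-m-1) (1-s)^(k+q)`. -/
theorem hasDbarAt_outerPotential {w q m : ℝ} (hm : 0 < m) {k : ℕ} (P : Polynomial ℂ) {z : ℂ}
    (hz : z ≠ 0) (hu : 1 - w / z ∈ Complex.slitPlane) :
    HasDbarAt (outerPotential w q m k P) (planarDensity w q m k P z) z := by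
  have hσ := hasDbarAt_sphericalRatio w z
  have hs := one_sub_sphericalRatio_mem_slitPlane hz hu
  have hd : DifferentiableAt ℂ (fun z : ℂ => P.eval z * (1 - w / z) ^ (q : ℂ) * (z ^ (k + 1))⁻¹) z := by
    have h1 : DifferentiableAt ℂ (fun z : ℂ => (1 - w / z) ^ (q : ℂ)) z :=
      DifferentiableAt.cpow_const ((differentiableAt_const _).sub
        ((differentiableAt_const _).div differentiableAt_id hz)) hu
    have h2 : DifferentiableAt ℂ (fun z : ℂ => (z ^ (k + 1))⁻¹) z :=
      (differentiableAt_pow (k + 1)).fun_inv (pow_ne_zero _ hz)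
    exact (P.differentiableAt.fun_mul h1).fun_mul h2
  have main := ((HasDbarAt.of_differentiableAt hd).mul
    (((hasDbarAt_sphericalFactor z).cpow_const (sphericalFactor_mem_slitPlane z) (-m : ℂ)).mul
      (hσ.comp (hasDerivAt_eulerIntegral hm (k + q) hs)))).neg
  have ode := eulerIntegral_ode hm (k + q) hs
  have hR1 := cpow_sub_one_mul (sphericalFactor_ne_zero z) (-m : ℂ)
  have hkey := cpow_mul_one_sub_sphericalRatio_cpow hz hu q
  have hs0 := Complex.slitPlane_ne_zero hs
  have hρ0 := sphericalFactor_ne_zero z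
  have hρ := mul_inv_cancel₀ hρ0
  have hpow : (1 - sphericalRatio w z) ^ ((k + q : ℝ) : ℂ) =
      z ^ k * (conj z - w) ^ k * (sphericalFactor z)⁻¹ ^ k *
        (1 - sphericalRatio w z) ^ (q : ℂ) := by
    rw [Complex.ofReal_add, Complex.cpow_add _ _ hs0, Complex.ofReal_natCast, Complex.cpow_natCast,
      ← mul_pow, ← mul_pow, ← one_sub_sphericalRatio]
  have hsplit : sphericalFactor z ^ (-(m + k + q + 1) : ℂ) =
      sphericalFactor z ^ (-m - 1 : ℂ) * sphericalFactor z ^ (-q : ℂ) *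
        (sphericalFactor z)⁻¹ ^ k := by
    rw [inv_pow, ← Complex.cpow_natCast, ← Complex.cpow_neg, ← Complex.cpow_add _ _ hρ0,
      ← Complex.cpow_add _ _ hρ0]
    ring_nf
  have hz1 : z * z ^ k * (z ^ (k + 1))⁻¹ = 1 := by
    rw [← pow_succ']; exact mul_inv_cancel₀ (pow_ne_zero _ hz)
  refine main.congr_dbar ?_
  clear main hd
  rw [planarDensity, hsplit]
  rw [hpow] at ode
  generalize ((z - (w : ℂ)) * (conj z - (w : ℂ))) ^ (q : ℂ) = A at *
  generalize conj z - (w : ℂ) = v at *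
  generalize sphericalFactor z ^ (-m - 1 : ℂ) = R' at *
  generalize sphericalFactor z ^ (-m : ℂ) = R at *
  generalize sphericalFactor z ^ (-q : ℂ) = Rq at *
  generalize (sphericalFactor z)⁻¹ = r at *
  generalize sphericalFactor z = t at *
  generalize eulerIntegralDeriv m (k + q) (sphericalRatio w z) = E' at *
  generalize eulerIntegral m (k + q) (sphericalRatio w z) = E at *
  generalize (1 - sphericalRatio w z) ^ (q : ℂ) = Q at *
  generalize sphericalRatio w z = s at *
  generalize (1 - (w : ℂ) / z) ^ (q : ℂ) = U at *
  generalize (z ^ (k + 1))⁻¹ = Z at *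
  generalize P.eval z = p at *
  have h2 : R * r = R' := by rw [← hR1]; linear_combination R' * hρ
  linear_combination (p * U * Z * E' * s * z) * h2 + (p * U * Z * R' * z) * ode +
    (p * R' * v ^ k * r ^ k * U * Q) * hz1 + (p * R' * v ^ k * r ^ k) * hkey

theorem innerPotential_sub_outerPotential {w q m : ℝ} (hm : 0 < m) (hq : 0 < q) (k : ℕ) :
    ∃ B : ℂ, B ≠ 0 ∧ ∀ (P : Polynomial ℂ) (z : ℂ), z ≠ 0 → 1 - w / z ∈ Complex.slitPlane →
      1 + z * w ∈ Complex.slitPlane →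
      innerPotential w q m k P z - outerPotential w q m k P z = B * contourKernel w q m k P z := by
  obtain ⟨B, hB, h⟩ := exists_eulerIntegral_connection hm (e := k + q) (by positivity)
  refine ⟨B, hB, fun P z hz hu hzw => ?_⟩
  have hs1 := one_sub_sphericalRatio_mem_slitPlane hz hu
  have hρ := one_add_norm_sq_pos z
  have hρ0 := sphericalFactor_ne_zero z
  have hsr : sphericalRatio w z = ((1 + ‖z‖ ^ 2 : ℝ)⁻¹ : ℝ) * (1 + z * w) := by
    rw [sphericalRatio, sphericalFactor_eq, Complex.ofReal_inv, mul_comm]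
  have hs : sphericalRatio w z ∈ Complex.slitPlane := by
    rw [hsr]
    exact real_mul_mem_slitPlane (inv_pos.2 hρ) hzw
  have hs0 := Complex.slitPlane_ne_zero hs
  have hs10 := Complex.slitPlane_ne_zero hs1
  have hB' := h _ hs hs1
  have hkey := cpow_mul_one_sub_sphericalRatio_cpow hz hu q
  have hpow : (1 - sphericalRatio w z) ^ ((k + q + 1 : ℝ) : ℂ) =
      z ^ (k + 1) * (conj z - w) ^ (k + 1) * (sphericalFactor z)⁻¹ ^ (k + 1) *
        (1 - sphericalRatio w z) ^ (q : ℂ) := by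
    rw [show (k + q + 1 : ℝ) = ((k + 1 : ℕ) : ℝ) + q by push_cast; ring, Complex.ofReal_add,
      Complex.cpow_add _ _ hs10, Complex.ofReal_natCast, Complex.cpow_natCast,
      ← mul_pow, ← mul_pow, ← one_sub_sphericalRatio]
  have hsplit : sphericalFactor z ^ (-(m + k + q + 1) : ℂ) =
      sphericalFactor z ^ (-m : ℂ) * sphericalFactor z ^ (-q : ℂ) *
        (sphericalFactor z)⁻¹ ^ (k + 1) := by
    rw [inv_pow, ← Complex.cpow_natCast, ← Complex.cpow_neg, ← Complex.cpow_add _ _ hρ0,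
      ← Complex.cpow_add _ _ hρ0]
    push_cast
    ring_nf
  -- The power splits without a branch correction because `1 + |z|²` is a positive real.
  have hprod : (1 + z * w) ^ (-m : ℂ) =
      sphericalFactor z ^ (-m : ℂ) * sphericalRatio w z ^ (-m : ℂ) := by
    have e : 1 + z * w = ((1 + ‖z‖ ^ 2 : ℝ) : ℂ) * sphericalRatio w z := by
      rw [← sphericalFactor_eq, sphericalRatio]; field_simp
    rw [e, Complex.cpow_def_of_ne_zero (mul_ne_zero (by exact_mod_cast hρ.ne') hs0),
      Complex.log_ofReal_mul hρ hs0, sphericalFactor_eq,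
      Complex.cpow_def_of_ne_zero (by exact_mod_cast hρ.ne'), Complex.cpow_def_of_ne_zero hs0,
      ← Complex.exp_add, Complex.ofReal_log hρ.le]
    ring_nf
  have hinv : sphericalRatio w z ^ (-m : ℂ) * sphericalRatio w z ^ (m : ℂ) = 1 := by
    rw [← Complex.cpow_add _ _ hs0, neg_add_cancel, Complex.cpow_zero]
  have hz1 : z ^ (k + 1) * (z ^ (k + 1))⁻¹ = 1 := mul_inv_cancel₀ (pow_ne_zero _ hz)
  rw [hpow] at hB'
  rw [innerPotential, outerPotential, contourKernel, hsplit, hprod]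
  generalize ((z - (w : ℂ)) * (conj z - (w : ℂ))) ^ (q : ℂ) = A at *
  generalize (conj z - (w : ℂ)) ^ (k + 1) = v at *
  generalize (z ^ (k + 1))⁻¹ = Z at *
  generalize z ^ (k + 1) = z' at *
  generalize (sphericalFactor z)⁻¹ ^ (k + 1) = r at *
  generalize sphericalFactor z ^ (-m : ℂ) = R at *
  generalize sphericalFactor z ^ (-q : ℂ) = Rq at *
  generalize eulerIntegral m (k + q) (sphericalRatio w z) = E at *
  generalize eulerIntegral (k + q + 1) (m - 1) (1 - sphericalRatio w z) = E' at *
  generalize (1 - sphericalRatio w z) ^ (q : ℂ) = Q at *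
  generalize sphericalRatio w z ^ (-m : ℂ) = T' at *
  generalize sphericalRatio w z ^ (m : ℂ) = T at *
  generalize (1 - (w : ℂ) / z) ^ (q : ℂ) = U at *
  generalize P.eval z = p at *
  linear_combination (p * U * Z * R * T') * hB' - (p * U * Z * R * E) * hinv -
    (p * v * R * r * T' * E') * hkey - (p * v * R * r * T' * E' * U * Q) * hz1

/-! ### Exhausting the plane by squares -/

/-- The iterated integral of `f` over `[a, b] × [c, d]`. -/
def rectArea (f : ℂ → ℂ) (a b c d : ℝ) : ℂ :=
  ∫ x : ℝ in a..b, ∫ y : ℝ in c..d, f (x + y * Complex.I)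

theorem rectArea_split {f : ℂ → ℂ} (hf : Continuous f) (a b R : ℝ) :
    rectArea f (-R) R (-R) R = rectArea f (-R) a (-R) R + rectArea f b R (-R) R +
      rectArea f a b (-R) (-1) + rectArea f a b 1 R + rectArea f a b (-1) 1 := by
  have hy : ∀ (x c d : ℝ), IntervalIntegrable (fun y : ℝ => f (x + y * Complex.I)) volume c d :=
    fun x c d => Continuous.intervalIntegrable (by fun_prop) c d
  have hx : ∀ (a b c d : ℝ), IntervalIntegrable
      (fun x : ℝ => ∫ y : ℝ in c..d, f (x + y * Complex.I)) volume a b := fun a b c d =>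
    (intervalIntegral.continuous_parametric_intervalIntegral_of_continuous'
      (by unfold Function.uncurry; fun_prop) c d).intervalIntegrable a b
  have hmid : rectArea f a b (-R) R =
      rectArea f a b (-R) (-1) + rectArea f a b 1 R + rectArea f a b (-1) 1 := by
    simp only [rectArea]
    rw [← intervalIntegral.integral_add (hx _ _ _ _) (hx _ _ _ _),
      ← intervalIntegral.integral_add ((hx _ _ _ _).add (hx _ _ _ _)) (hx _ _ _ _)]
    congr 1; ext x
    rw [← intervalIntegral.integral_add_adjacent_intervals (hy x (-R) (-1)) (hy x (-1) R),
      ← intervalIntegral.integral_add_adjacent_intervals (hy x (-1) 1) (hy x 1 R)]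
    ring
  have h1 : rectArea f (-R) R (-R) R =
      rectArea f (-R) a (-R) R + (rectArea f a b (-R) R + rectArea f b R (-R) R) := by
    simp only [rectArea]
    rw [intervalIntegral.integral_add_adjacent_intervals (hx _ _ _ _) (hx _ _ _ _),
      intervalIntegral.integral_add_adjacent_intervals (hx _ _ _ _) (hx _ _ _ _)]
  rw [h1, hmid]; ring

/-- The complement of the open rectangle `(a, b) × (-1, 1)`. -/
def rectExterior (a b : ℝ) : Set ℂ := {z | z.re ≤ a ∨ b ≤ z.re ∨ z.im ≤ -1 ∨ 1 ≤ z.im}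

/-- The square is cut into two full-height columns, blocks below and above the centre, and the
central rectangle; integrals over shared sides cancel. Nothing is assumed of `F` inside the central
rectangle, where the outer potential is singular. -/
theorem rectIntegral_split {F : ℂ → ℂ} {a b R : ℝ} (hF : ContinuousOn F (rectExterior a b))
    (ha : -R ≤ a) (hab : a ≤ b) (hb : b ≤ R) (hR : 1 ≤ R) :
    rectIntegral F (-R) R (-R) R = rectIntegral F (-R) a (-R) R + rectIntegral F b R (-R) R +
      rectIntegral F a b (-R) (-1) + rectIntegral F a b 1 R + rectIntegral F a b (-1) 1 := by
  have hbot : ∀ {x y : ℝ}, x ≤ y →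
      IntervalIntegrable (fun x : ℝ => F (x + (-R : ℝ) * Complex.I)) volume x y := fun h =>
    intervalIntegrable_horizontal h (hF.mono fun z hz => by
      right; right; left; rw [hz.2]; linarith)
  have htop : ∀ {x y : ℝ}, x ≤ y →
      IntervalIntegrable (fun x : ℝ => F (x + (R : ℝ) * Complex.I)) volume x y := fun h =>
    intervalIntegrable_horizontal h (hF.mono fun z hz => by
      right; right; right; rw [hz.2]; linarith)
  have hleft : ∀ {x y : ℝ}, x ≤ y →
      IntervalIntegrable (fun y : ℝ => F (a + y * Complex.I)) volume x y := fun h =>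
    intervalIntegrable_vertical h (hF.mono fun z hz => Or.inl hz.2.le)
  have hright : ∀ {x y : ℝ}, x ≤ y →
      IntervalIntegrable (fun y : ℝ => F (b + y * Complex.I)) volume x y := fun h =>
    intervalIntegrable_vertical h (hF.mono fun z hz => Or.inr (Or.inl hz.2.ge))
  have n1 : (-1 : ℝ) ≤ 1 := by norm_num
  have n2 : -R ≤ -1 := by linarith
  have e1 := intervalIntegral.integral_add_adjacent_intervals (hbot ha) (hbot (hab.trans hb))
  have e2 := intervalIntegral.integral_add_adjacent_intervals (hbot hab) (hbot hb)
  have e3 := intervalIntegral.integral_add_adjacent_intervals (htop ha) (htop (hab.trans hb))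
  have e4 := intervalIntegral.integral_add_adjacent_intervals (htop hab) (htop hb)
  have e5 := intervalIntegral.integral_add_adjacent_intervals (hleft n2) (hleft (n1.trans hR))
  have e6 := intervalIntegral.integral_add_adjacent_intervals (hleft n1) (hleft hR)
  have e7 := intervalIntegral.integral_add_adjacent_intervals (hright n2) (hright (n1.trans hR))
  have e8 := intervalIntegral.integral_add_adjacent_intervals (hright n1) (hright hR)
  simp only [rectIntegral, smul_eq_mul]
  rw [← e1, ← e2, ← e3, ← e4, ← e5, ← e6, ← e7, ← e8]
  ring

theorem tendsto_rectArea {f : ℂ → ℂ} (hf : Integrable f) :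
    Tendsto (fun R : ℝ => rectArea f (-R) R (-R) R) atTop (𝓝 (∫ z, f z)) := by
  have hmp := Complex.volume_preserving_equiv_real_prod.symm
  have hg : Integrable (fun p : ℝ × ℝ => f (p.1 + p.2 * Complex.I)) := by
    have := (hmp.integrable_comp_emb (MeasurableEquiv.measurableEmbedding _)).2 hf
    refine this.congr (Eventually.of_forall fun p => ?_)
    simp [Complex.mk_eq_add_mul_I]
  have hint : ∫ z, f z = ∫ p : ℝ × ℝ, f (p.1 + p.2 * Complex.I) := by
    rw [← hmp.integral_comp (MeasurableEquiv.measurableEmbedding _)]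
    congr 1; ext p
    simp [Complex.mk_eq_add_mul_I]
  have hcover : AECover (volume : Measure (ℝ × ℝ)) atTop
      (fun R : ℝ => Ioc (-R) R ×ˢ Ioc (-R) R) := by
    refine ⟨Eventually.of_forall fun p => ?_, fun R => measurableSet_Ioc.prod measurableSet_Ioc⟩
    filter_upwards [eventually_gt_atTop |p.1|, eventually_gt_atTop |p.2|] with R h1 h2
    rw [abs_lt] at h1 h2
    exact ⟨⟨h1.1, h1.2.le⟩, ⟨h2.1, h2.2.le⟩⟩
  rw [hint]
  refine (hcover.integral_tendsto_of_countably_generated hg).congr' ?_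
  filter_upwards [eventually_ge_atTop 0] with R hR
  rw [rectArea, intervalIntegral.integral_of_le (by linarith), Measure.volume_eq_prod,
    setIntegral_prod _ hg.integrableOn]
  simp only [intervalIntegral.integral_of_le (show -R ≤ R by linarith)]

theorem norm_rectIntegral_square_le {F : ℂ → ℂ} {R C : ℝ} (hR : 0 ≤ R)
    (hF : ∀ z : ℂ, R ≤ ‖z‖ → ‖F z‖ ≤ C) : ‖rectIntegral F (-R) R (-R) R‖ ≤ 8 * (C * R) := by
  have him : ∀ x r : ℝ, |r| = R → R ≤ ‖(x : ℂ) + r * Complex.I‖ := fun x r hr => by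
    have := Complex.abs_im_le_norm ((x : ℂ) + r * Complex.I)
    simpa [hr] using this
  have hre : ∀ x r : ℝ, |r| = R → R ≤ ‖(r : ℂ) + x * Complex.I‖ := fun x r hr => by
    have := Complex.abs_re_le_norm ((r : ℂ) + x * Complex.I)
    simpa [hr] using this
  have h1 : |R| = R := abs_of_nonneg hR
  have h2 : |-R| = R := by rw [abs_neg, h1]
  have hlen : |R - -R| = 2 * R := by rw [abs_of_nonneg] <;> linarith
  have hh : ∀ r : ℝ, |r| = R → ‖∫ x : ℝ in (-R)..R, F (x + r * Complex.I)‖ ≤ C * (2 * R) :=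
    fun r hr => hlen ▸ intervalIntegral.norm_integral_le_of_norm_le_const
      fun x _ => hF _ (him x r hr)
  have hv : ∀ r : ℝ, |r| = R →
      ‖Complex.I • ∫ y : ℝ in (-R)..R, F (r + y * Complex.I)‖ ≤ C * (2 * R) := fun r hr => by
    rw [norm_smul, Complex.norm_I, one_mul]
    exact hlen ▸ intervalIntegral.norm_integral_le_of_norm_le_const fun x _ => hF _ (hre x r hr)
  rw [rectIntegral]
  have a1 := norm_sub_le ((∫ x : ℝ in (-R)..R, F (x + (-R : ℝ) * Complex.I)) -
    (∫ x : ℝ in (-R)..R, F (x + R * Complex.I)) +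
    Complex.I • (∫ y : ℝ in (-R)..R, F (R + y * Complex.I)))
    (Complex.I • ∫ y : ℝ in (-R)..R, F ((-R : ℝ) + y * Complex.I))
  have a2 := norm_add_le ((∫ x : ℝ in (-R)..R, F (x + (-R : ℝ) * Complex.I)) -
    (∫ x : ℝ in (-R)..R, F (x + R * Complex.I)))
    (Complex.I • (∫ y : ℝ in (-R)..R, F (R + y * Complex.I)))
  have a3 := norm_sub_le (∫ x : ℝ in (-R)..R, F (x + (-R : ℝ) * Complex.I))
    (∫ x : ℝ in (-R)..R, F (x + R * Complex.I))
  linarith [hh R h1, hh (-R) h2, hv R h1, hv (-R) h2]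

/-- Stokes' theorem for two potentials of the same density, one regular on the closed rectangle
`[a, b] × [-1, 1]` and the other one regular outside of it and small at infinity. -/
theorem integral_eq_rectIntegral_sub {f F G : ℂ → ℂ} {a b : ℝ} (hab : a ≤ b) {s : Set ℂ}
    (hs : s.Countable) (hf : Continuous f) (hfi : Integrable f)
    (hF : ContinuousOn F (Icc a b ×ℂ Icc (-1) 1))
    (hFd : ∀ z ∈ (Icc a b ×ℂ Icc (-1) 1) \ s, HasDbarAt F (f z) z)
    (hGd : ∀ z ∈ rectExterior a b, HasDbarAt G (f z) z)
    {K r t : ℝ} (ht : 0 < t) (hG : ∀ z : ℂ, r ≤ ‖z‖ → ‖G z‖ ≤ K * ‖z‖ ^ (-t - 1)) :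
    2 * Complex.I * ∫ z, f z = rectIntegral (fun z => F z - G z) a b (-1) 1 := by
  have hGc : ContinuousOn G (rectExterior a b) :=
    fun z hz => (hGd z hz).continuousAt.continuousWithinAt
  have hsub : rectBoundary a b (-1) 1 ⊆ rectExterior a b := by
    rintro z (⟨-, h | h⟩ | ⟨-, h | h⟩)
    exacts [Or.inr (Or.inr (Or.inl h.le)), Or.inr (Or.inr (Or.inr h.ge)), Or.inl h.le,
      Or.inr (Or.inl h.ge)]
  have hsub' : rectBoundary a b (-1) 1 ⊆ Icc a b ×ℂ Icc (-1) 1 := by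
    rintro z (⟨h', h | h⟩ | ⟨h', h | h⟩)
    · exact ⟨h', by simp [h]⟩
    · exact ⟨h', by simp [h]⟩
    · exact ⟨by simp [h, hab], h'⟩
    · exact ⟨by simp [h, hab], h'⟩
  have hstokes : ∀ {a' b' c' d' : ℝ}, a' ≤ b' → c' ≤ d' →
      (Icc a' b' ×ℂ Icc c' d' ⊆ rectExterior a b) →
      rectIntegral G a' b' c' d' = 2 * Complex.I * rectArea f a' b' c' d' := fun h1 h2 h3 =>
    rectIntegral_eq_integral_dbar h1 h2 countable_empty (hGc.mono h3)
      (fun z hz => hGd z (h3 hz.1)) hf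
  -- Stokes applies to `G` on the four outer blocks and to `F` on the central one; the integral of
  -- `F - G` corrects the exchange.
  have hbig : ∀ᶠ R in atTop, rectIntegral G (-R) R (-R) R +
      rectIntegral (fun z => F z - G z) a b (-1) 1 = 2 * Complex.I * rectArea f (-R) R (-R) R := by
    filter_upwards [eventually_ge_atTop 1, eventually_ge_atTop (-a), eventually_ge_atTop b]
      with R h1 h2 h3
    rw [rectIntegral_split hGc (by linarith) hab h3 h1, rectArea_split hf a b R,
      rectIntegral_sub hab (by norm_num) (hF.mono hsub') (hGc.mono hsub),
      rectIntegral_eq_integral_dbar hab (by norm_num) hs hF hFd hf,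
      hstokes (by linarith) (by linarith) fun z hz => Or.inl hz.1.2,
      hstokes h3 (by linarith) fun z hz => Or.inr (Or.inl hz.1.1),
      hstokes hab (by linarith) fun z hz => Or.inr (Or.inr (Or.inl hz.2.2)),
      hstokes hab (by linarith) fun z hz => Or.inr (Or.inr (Or.inr hz.2.1))]
    change _ + (2 * Complex.I * rectArea f a b (-1) 1 - _) = _
    ring
  -- Decay `R^(-t-1)` against perimeter `8R` leaves `R^(-t)`.
  have hlim : Tendsto (fun R : ℝ => rectIntegral G (-R) R (-R) R) atTop (𝓝 0) := by
    have h0 : Tendsto (fun R : ℝ => 8 * (|K| * R ^ (-t))) atTop (𝓝 0) := by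
      simpa using ((tendsto_rpow_neg_atTop ht).const_mul |K|).const_mul 8
    refine squeeze_zero_norm' ?_ h0
    filter_upwards [eventually_ge_atTop 1, eventually_ge_atTop r] with R h1 h2
    have hR : 0 < R := by linarith
    refine (norm_rectIntegral_square_le (C := |K| * R ^ (-t - 1)) hR.le fun z hz => ?_).trans
      (le_of_eq ?_)
    · refine (hG z (h2.trans hz)).trans ?_
      have h3 : ‖z‖ ^ (-t - 1) ≤ R ^ (-t - 1) :=
        Real.rpow_le_rpow_of_nonpos hR hz (by linarith)
      exact (mul_le_mul_of_nonneg_right (le_abs_self K) (by positivity)).trans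
        (mul_le_mul_of_nonneg_left h3 (abs_nonneg K))
    · rw [mul_assoc |K|, Real.rpow_sub_one hR.ne', div_mul_cancel₀ _ hR.ne']
  refine tendsto_nhds_unique_of_eventuallyEq (f := fun R : ℝ => 2 * Complex.I *
    rectArea f (-R) R (-R) R) (g := fun R : ℝ => rectIntegral G (-R) R (-R) R +
      rectIntegral (fun z => F z - G z) a b (-1) 1) ((tendsto_rectArea hfi).const_mul _) ?_
    (hbig.mono fun R h => h.symm)
  simpa using hlim.add_const (rectIntegral (fun z => F z - G z) a b (-1) 1)

/-! ### Growth estimates -/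

theorem exists_norm_eval_le {P : Polynomial ℂ} {n : ℕ} (hP : P.natDegree ≤ n) :
    ∃ C : ℝ, 0 ≤ C ∧ ∀ z : ℂ, ‖P.eval z‖ ≤ C * (1 + ‖z‖) ^ n := by
  refine ⟨∑ i ∈ Finset.range (n + 1), ‖P.coeff i‖, by positivity, fun z => ?_⟩
  rw [Polynomial.eval_eq_sum_range' (Nat.lt_succ_of_le hP), Finset.sum_mul]
  refine (norm_sum_le _ _).trans (Finset.sum_le_sum fun i hi => ?_)
  rw [norm_mul, norm_pow]
  have hi' : i ≤ n := Nat.lt_succ_iff.1 (Finset.mem_range.1 hi)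
  have h0 := norm_nonneg z
  refine mul_le_mul_of_nonneg_left ?_ (norm_nonneg _)
  exact (pow_le_pow_left₀ h0 (by linarith) i).trans (pow_le_pow_right₀ (by linarith) hi')

theorem planarDensity_eq (w q m : ℝ) (k : ℕ) (P : Polynomial ℂ) (z : ℂ) :
    planarDensity w q m k P z = P.eval z * (conj (z - (w : ℂ))) ^ k *
      ((‖z - w‖ ^ (2 * q) / (1 + ‖z‖ ^ 2) ^ (m + k + q + 1) : ℝ) : ℂ) := by
  have hρ := one_add_norm_sq_pos z
  have h : (-(m + k + q + 1) : ℂ) = ((-(m + k + q + 1) : ℝ) : ℂ) := by push_cast; ring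
  rw [planarDensity, mul_conj_sub_eq, sphericalFactor_eq, h, ← Complex.ofReal_cpow (by positivity),
    ← Complex.ofReal_cpow hρ.le, Real.rpow_neg hρ.le, map_sub, Complex.conj_ofReal,
    ← Real.rpow_natCast, ← Real.rpow_mul (norm_nonneg _), Complex.ofReal_div, Complex.ofReal_inv]
  push_cast
  ring

theorem continuous_planarDensity {w q m : ℝ} (hq : 0 < q) (k : ℕ) (P : Polynomial ℂ) :
    Continuous (planarDensity w q m k P) := by
  have h : planarDensity w q m k P = fun z : ℂ => P.eval z * (conj (z - (w : ℂ))) ^ k *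
      ((‖z - w‖ ^ (2 * q) / (1 + ‖z‖ ^ 2) ^ (m + k + q + 1) : ℝ) : ℂ) :=
    funext (planarDensity_eq w q m k P)
  rw [h]
  have h1 : Continuous fun z : ℂ => ‖z - w‖ ^ (2 * q) :=
    Continuous.rpow_const (by fun_prop) fun _ => Or.inr (by linarith)
  have h2 : Continuous fun z : ℂ => (1 + ‖z‖ ^ 2) ^ (m + k + q + 1) :=
    Continuous.rpow_const (by fun_prop) fun z => Or.inl (one_add_norm_sq_pos z).ne'
  have h3 := h1.div h2 fun z => (Real.rpow_pos_of_pos (one_add_norm_sq_pos z) _).ne'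
  exact (P.continuous.mul (by fun_prop)).mul (Complex.continuous_ofReal.comp h3)

theorem integrable_planarDensity {w q m : ℝ} (hw : 0 < w) (hq : 0 < q) (hm : 0 < m) {k n : ℕ}
    (hnk : n < 2 * m + k) {P : Polynomial ℂ} (hP : P.natDegree ≤ n) :
    Integrable (planarDensity w q m k P) := by
  obtain ⟨C, hC, hP'⟩ := exists_norm_eval_le hP
  -- The decay exponent `2(m + k + q + 1) - n - k - 2q` of the density; integrability in the plane
  -- asks for `r > 2`.
  set r : ℝ := 2 * m + k + 2 - n
  have hr : (Module.finrank ℝ ℂ : ℝ) < r := by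
    rw [Complex.finrank_real_complex]; push_cast; linarith
  set s : ℝ := m + k + q + 1
  have hs : 0 < s := by positivity
  have hdom := (integrable_one_add_norm (μ := (volume : Measure ℂ)) hr).const_mul
    (C * (1 + w) ^ k * (1 + w) ^ (2 * q) * 2 ^ s)
  refine hdom.mono' (continuous_planarDensity hq k P).aestronglyMeasurable
    (Eventually.of_forall fun z => ?_)
  have hz := norm_nonneg z
  have hx : 0 < 1 + ‖z‖ := by linarith
  have h1 : ‖z - w‖ ≤ (1 + w) * (1 + ‖z‖) := by
    refine (norm_sub_le _ _).trans ?_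
    rw [Complex.norm_real, Real.norm_of_nonneg hw.le]
    nlinarith
  have h2 : (1 + ‖z‖) ^ 2 / 2 ≤ 1 + ‖z‖ ^ 2 := by nlinarith [sq_nonneg (1 - ‖z‖)]
  have h3 : ‖z - w‖ ^ k ≤ (1 + w) ^ k * (1 + ‖z‖) ^ k := by
    rw [← mul_pow]; exact pow_le_pow_left₀ (norm_nonneg _) h1 k
  have h4 : ‖z - w‖ ^ (2 * q) ≤ (1 + w) ^ (2 * q) * (1 + ‖z‖) ^ (2 * q) := by
    rw [← Real.mul_rpow (by linarith) hx.le]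
    exact Real.rpow_le_rpow (norm_nonneg _) h1 (by linarith)
  have h5 : ((1 + ‖z‖ ^ 2) ^ s)⁻¹ ≤ 2 ^ s * (1 + ‖z‖) ^ (-(2 * s)) := by
    have h6 : ((1 + ‖z‖) ^ 2 / 2) ^ s ≤ (1 + ‖z‖ ^ 2) ^ s :=
      Real.rpow_le_rpow (by positivity) h2 hs.le
    refine (inv_anti₀ (by positivity) h6).trans (le_of_eq ?_)
    rw [Real.div_rpow (by positivity) (by norm_num), inv_div, Real.rpow_neg hx.le,
      Real.rpow_mul hx.le, div_eq_mul_inv]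
    norm_cast
  rw [planarDensity_eq, norm_mul, norm_mul, norm_pow, RCLike.norm_conj, Complex.norm_real,
    Real.norm_of_nonneg (by positivity), div_eq_mul_inv]
  calc _ ≤ (C * (1 + ‖z‖) ^ n) * ((1 + w) ^ k * (1 + ‖z‖) ^ k) *
        (((1 + w) ^ (2 * q) * (1 + ‖z‖) ^ (2 * q)) * (2 ^ s * (1 + ‖z‖) ^ (-(2 * s)))) := by
        gcongr
        exact hP' z
    _ = C * (1 + w) ^ k * (1 + w) ^ (2 * q) * 2 ^ s * ((1 + ‖z‖) ^ (n : ℝ) *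
          (1 + ‖z‖) ^ (k : ℝ) * (1 + ‖z‖) ^ (2 * q) * (1 + ‖z‖) ^ (-(2 * s))) := by
        rw [Real.rpow_natCast, Real.rpow_natCast]; ring
    _ = _ := by
        rw [← Real.rpow_add hx, ← Real.rpow_add hx, ← Real.rpow_add hx]
        congr 2
        simp only [s, r]; ring

/-- At infinity `s → 0`, where the Euler integral is continuous and thus bounded. The remaining
factors have total order `n - (k + 1) - 2m`. -/
theorem norm_outerPotential_le {w q m : ℝ} (hw : 0 < w) (hq : 0 < q) (hm : 0 < m) (k : ℕ) {n : ℕ}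
    {P : Polynomial ℂ} (hP : P.natDegree ≤ n) :
    ∃ K r : ℝ, ∀ z : ℂ, r ≤ ‖z‖ →
      ‖outerPotential w q m k P z‖ ≤ K * ‖z‖ ^ (-(2 * m + k - n) - 1) := by
  obtain ⟨C, hC, hP'⟩ := exists_norm_eval_le hP
  have hE : ContinuousAt (eulerIntegral m (k + q)) 0 :=
    (hasDerivAt_eulerIntegral hm (k + q) (by simp)).continuousAt
  obtain ⟨δ, hδ, hEδ⟩ := Metric.continuousAt_iff.1 hE 1 one_pos
  set E₀ : ℝ := ‖eulerIntegral m (k + q) 0‖ + 1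
  refine ⟨C * 2 ^ n * (1 + w) ^ q * E₀, max 1 ((1 + w) / δ + 1), fun z hz => ?_⟩
  have hz1 : 1 ≤ ‖z‖ := (le_max_left _ _).trans hz
  have hz0 : 0 < ‖z‖ := by linarith
  have hzδ : (1 + w) / δ < ‖z‖ := by linarith [(le_max_right 1 ((1 + w) / δ + 1)).trans hz]
  have hzw : ‖(1 : ℂ) + z * w‖ ≤ (1 + w) * ‖z‖ := by
    refine (norm_add_le _ _).trans ?_
    rw [norm_mul, Complex.norm_real, Real.norm_of_nonneg hw.le, norm_one]
    nlinarith
  have hρ := one_add_norm_sq_pos z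
  have h1 : ‖P.eval z‖ ≤ C * 2 ^ n * ‖z‖ ^ n := by
    refine (hP' z).trans ?_
    rw [mul_assoc, ← mul_pow]
    gcongr
    linarith
  have h2 : ‖(1 - w / z : ℂ) ^ (q : ℂ)‖ ≤ (1 + w) ^ q := by
    rw [Complex.norm_cpow_real]
    refine Real.rpow_le_rpow (norm_nonneg _) ((norm_sub_le _ _).trans ?_) hq.le
    rw [norm_one, norm_div, Complex.norm_real, Real.norm_of_nonneg hw.le]
    gcongr
    exact div_le_self hw.le hz1
  have h3 : ‖sphericalFactor z ^ (-m : ℂ)‖ ≤ ‖z‖ ^ (-(2 * m)) := by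
    rw [← Complex.ofReal_neg, Complex.norm_cpow_real, sphericalFactor_eq, Complex.norm_real,
      Real.norm_of_nonneg hρ.le, ← mul_neg, Real.rpow_mul hz0.le]
    norm_cast
    exact Real.rpow_le_rpow_of_nonpos (by positivity) (by linarith) (by linarith)
  have h4 : ‖eulerIntegral m (k + q) (sphericalRatio w z)‖ ≤ E₀ := by
    have h5 : ‖sphericalRatio w z‖ < δ := by
      rw [sphericalRatio, norm_mul, norm_inv, sphericalFactor_eq, Complex.norm_real,
        Real.norm_of_nonneg hρ.le, ← div_eq_mul_inv, div_lt_iff₀ hρ]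
      rw [div_lt_iff₀ hδ] at hzδ
      nlinarith
    have h6 := hEδ (x := sphericalRatio w z) (by simpa using h5)
    rw [dist_eq_norm] at h6
    have := norm_sub_norm_le (eulerIntegral m (k + q) (sphericalRatio w z))
      (eulerIntegral m (k + q) 0)
    simp only [E₀]
    linarith
  rw [outerPotential, norm_neg, norm_mul, norm_mul, norm_mul, norm_mul, norm_inv, norm_pow]
  have hE0 : 0 ≤ E₀ := by positivity
  calc _ ≤ (C * 2 ^ n * ‖z‖ ^ n) * (1 + w) ^ q * (‖z‖ ^ (k + 1))⁻¹ *
        (‖z‖ ^ (-(2 * m)) * E₀) := by gcongr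
    _ = C * 2 ^ n * (1 + w) ^ q * E₀ * (‖z‖ ^ (n : ℝ) * ‖z‖ ^ (-((k + 1 : ℕ) : ℝ)) *
          ‖z‖ ^ (-(2 * m))) := by
        rw [Real.rpow_natCast, Real.rpow_neg hz0.le ((k + 1 : ℕ) : ℝ), Real.rpow_natCast]; ring
    _ = _ := by
        rw [← Real.rpow_add hz0, ← Real.rpow_add hz0]
        congr 2
        push_cast; ring

/-! ### Planar integrals as contour integrals -/

theorem one_sub_div_mem_slitPlane {w : ℝ} (hw : 0 < w) {z : ℂ}
    (hz : z.im ≠ 0 ∨ z.re < 0 ∨ w < z.re) : z ≠ 0 ∧ 1 - w / z ∈ Complex.slitPlane := by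
  have h0 : z ≠ 0 := by
    rintro rfl
    rcases hz with h | h | h
    · exact h rfl
    · exact lt_irrefl _ h
    · exact absurd h (not_lt.2 hw.le)
  refine ⟨h0, ?_⟩
  by_cases him : z.im = 0
  · have hz' : z = (z.re : ℂ) := by apply Complex.ext <;> simp [him]
    rw [hz', ← Complex.ofReal_div, ← Complex.ofReal_one, ← Complex.ofReal_sub,
      Complex.ofReal_mem_slitPlane, sub_pos]
    rcases hz with h | h | h
    · exact absurd him h
    · exact (div_neg_of_pos_of_neg hw h).trans one_pos
    · rwa [div_lt_one (hw.trans h)]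
  · right
    have hn : Complex.normSq z ≠ 0 := by simpa using h0
    simp [Complex.div_im, him, hn, hw.ne']

theorem one_add_mul_mem_slitPlane {w : ℝ} (hw : 0 < w) {z : ℂ}
    (hz : z.im ≠ 0 ∨ -1 / w < z.re) : 1 + z * w ∈ Complex.slitPlane := by
  rw [Complex.mem_slitPlane_iff]
  rcases hz with h | h
  · right; simpa using ⟨h, hw.ne'⟩
  · left
    rw [div_lt_iff₀ hw] at h
    simp only [Complex.add_re, Complex.one_re, Complex.mul_re, Complex.ofReal_re,
      Complex.ofReal_im, mul_zero, sub_zero]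
    linarith

theorem mem_slitPlane_of_mem_cutPlane {w : ℝ} (hw : 0 < w) {z : ℂ}
    (hz : z ∈ cutPlane (-1 / w) w) :
    z ≠ 0 ∧ 1 - w / z ∈ Complex.slitPlane ∧ 1 + z * w ∈ Complex.slitPlane := by
  have hl : -1 / w < 0 := div_neg_of_neg_of_pos (by norm_num) hw
  have h1 : z.im ≠ 0 ∨ z.re < 0 ∨ w < z.re := by
    rcases hz with h | h | h
    exacts [Or.inl h, Or.inr (Or.inr h), Or.inr (Or.inl h.2)]
  have h2 : z.im ≠ 0 ∨ -1 / w < z.re := by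
    rcases hz with h | h | h
    exacts [Or.inl h, Or.inr (hl.trans (hw.trans h)), Or.inr h.1]
  exact ⟨(one_sub_div_mem_slitPlane hw h1).1, (one_sub_div_mem_slitPlane hw h1).2,
    one_add_mul_mem_slitPlane hw h2⟩

theorem differentiableOn_contourKernel {w : ℝ} (hw : 0 < w) (q m : ℝ) (k : ℕ)
    (P : Polynomial ℂ) : DifferentiableOn ℂ (contourKernel w q m k P) (cutPlane (-1 / w) w) := by
  intro z hz
  obtain ⟨h0, h1, h2⟩ := mem_slitPlane_of_mem_cutPlane hw hz
  have d1 : DifferentiableAt ℂ (fun z : ℂ => (1 - w / z) ^ (q : ℂ)) z :=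
    DifferentiableAt.cpow_const ((differentiableAt_const _).sub
      ((differentiableAt_const _).div differentiableAt_id h0)) h1
  have d2 : DifferentiableAt ℂ (fun z : ℂ => (z ^ (k + 1))⁻¹) z :=
    (differentiableAt_pow (k + 1)).fun_inv (pow_ne_zero _ h0)
  have d3 : DifferentiableAt ℂ (fun z : ℂ => (1 + z * w) ^ (-m : ℂ)) z :=
    DifferentiableAt.cpow_const (by fun_prop) h2
  exact (((P.differentiableAt.fun_mul d1).fun_mul d2).fun_mul d3).differentiableWithinAt

theorem sphericalRatio_mem_slitPlane {w : ℝ} {z : ℂ} (hz : 1 + z * w ∈ Complex.slitPlane) :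
    sphericalRatio w z ∈ Complex.slitPlane := by
  rw [sphericalRatio, sphericalFactor_eq, ← Complex.ofReal_inv, mul_comm]
  exact real_mul_mem_slitPlane (inv_pos.2 (one_add_norm_sq_pos z)) hz

/-- This covers `z = w`, excluded from the `∂̄` computation because a power is taken at `0` there.
Stokes' theorem tolerates such a point if the potential is continuous, which `q > 0` ensures. -/
theorem continuousAt_innerPotential {w q m : ℝ} (hq : 0 < q) {k : ℕ} (P : Polynomial ℂ) {z : ℂ}
    (hs : sphericalRatio w z ∈ Complex.slitPlane) :
    ContinuousAt (innerPotential w q m k P) z := by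
  have hα : 0 < (k : ℝ) + q + 1 := by positivity
  have h : innerPotential w q m k P = fun z => planarDensity w q m k P z * ((conj z - w) *
      (sphericalRatio w z ^ (-m : ℂ) *
        eulerIntegral (k + q + 1) (m - 1) (1 - sphericalRatio w z))) := by
    ext z
    rw [innerPotential, planarDensity, pow_succ]
    ring
  have hσ : ContinuousAt (sphericalRatio w) z := (hasDbarAt_sphericalRatio w z).continuousAt
  have hE := (hasDerivAt_eulerIntegral hα (m - 1) (s := 1 - sphericalRatio w z)
    (by simpa using hs)).continuousAt
  have h1 : ContinuousAt (fun z => sphericalRatio w z ^ (-m : ℂ)) z :=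
    hσ.cpow continuousAt_const hs
  have h2 : ContinuousAt (fun z => eulerIntegral (k + q + 1) (m - 1) (1 - sphericalRatio w z)) z :=
    ContinuousAt.comp (f := fun z => 1 - sphericalRatio w z) hE (continuousAt_const.sub hσ)
  have h3 : ContinuousAt (fun z : ℂ => conj z - (w : ℂ)) z := Continuous.continuousAt (by fun_prop)
  rw [h]
  exact (continuous_planarDensity hq k P).continuousAt.mul (h3.mul (h1.mul h2))

theorem integral_planarDensity_eq {w q m : ℝ} (hw : 0 < w) (hq : 0 < q) (hm : 0 < m) {k n : ℕ}
    (hnk : n < 2 * m + k) :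
    ∃ B : ℂ, B ≠ 0 ∧ ∀ P : Polynomial ℂ, P.natDegree ≤ n →
      2 * Complex.I * ∫ z, planarDensity w q m k P z =
        B * rectIntegral (contourKernel w q m k P) (-1 / w / 2) (w + 1) (-1) 1 := by
  have hl : -1 / w < 0 := div_neg_of_neg_of_pos (by norm_num) hw
  obtain ⟨B, hB, h⟩ := innerPotential_sub_outerPotential (w := w) hm hq k
  refine ⟨B, hB, fun P hP => ?_⟩
  obtain ⟨K, r, hK⟩ := norm_outerPotential_le (k := k) hw hq hm hP
  have hs : ∀ z ∈ Icc (-1 / w / 2) (w + 1) ×ℂ Icc (-1 : ℝ) 1,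
      sphericalRatio w z ∈ Complex.slitPlane := fun z hz =>
    sphericalRatio_mem_slitPlane (one_add_mul_mem_slitPlane hw
      (Or.inr (by linarith [hz.1.1])))
  rw [integral_eq_rectIntegral_sub (by linarith) (countable_singleton (w : ℂ))
    (continuous_planarDensity hq k P) (integrable_planarDensity hw hq hm hnk hP)
    (fun z hz => (continuousAt_innerPotential hq P (hs z hz)).continuousWithinAt)
    (fun z hz => hasDbarAt_innerPotential hq P hz.2 (hs z hz.1))
    (fun z hz => ?_) (t := 2 * m + k - n) (by linarith) hK]
  · rw [← rectIntegral_const_mul]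
    refine rectIntegral_congr (by linarith) (by norm_num) fun z hz => ?_
    obtain ⟨h0, h1, h2⟩ := mem_slitPlane_of_mem_cutPlane hw (rectBoundary_subset_cutPlane hl hz)
    exact h P z h0 h1 h2
  · have hz' : z.im ≠ 0 ∨ z.re < 0 ∨ w < z.re := by
      rcases hz with h | h | h | h
      · exact Or.inr (Or.inl (by linarith))
      · exact Or.inr (Or.inr (by linarith))
      · exact Or.inl (by linarith)
      · exact Or.inl (by linarith)
    obtain ⟨h0, h1⟩ := one_sub_div_mem_slitPlane hw hz'
    exact hasDbarAt_outerPotential hm P h0 h1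

/-! ### From the kernels to the contour moments -/

theorem contourWeight_eq_of_mem_cutPlane (N Q₀ Q₁ : ℝ) {w : ℝ} (hw : 0 < w) (n : ℕ) {z : ℂ}
    (hz : z ∈ cutPlane (-1 / w) w) :
    contourWeight N Q₀ Q₁ w n z = (1 - (w : ℂ) / z) ^ ((N * Q₁ : ℝ) : ℂ) /
      ((1 + z * (w : ℂ)) ^ ((N + N * Q₀ : ℝ) : ℂ) * z ^ n) := by
  refine contourWeight_eq N Q₀ Q₁ w hw n z fun x hx hxw hzx => ?_
  subst hzx
  rcases hz with h | h | h
  · exact h (Complex.ofReal_im x)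
  · exact absurd h (not_lt.2 (by simpa using hxw))
  · exact absurd h.2 (not_lt.2 (by simpa using hx))

theorem contourKernel_eq (N Q₀ Q₁ : ℝ) {w : ℝ} (hw : 0 < w) {n k : ℕ} (hk : k < n)
    (P : Polynomial ℂ) {z : ℂ} (hz : z ∈ cutPlane (-1 / w) w) :
    contourKernel w (N * Q₁) (N + N * Q₀ - k) k P z =
      ∑ i ∈ Finset.range (k + 1), ((w : ℂ) ^ i * (k.choose i : ℂ)) *
        (P.eval z * z ^ (n - 1 - k + i) * contourWeight N Q₀ Q₁ w n z) := by
  obtain ⟨h0, h1, h2⟩ := mem_slitPlane_of_mem_cutPlane hw hz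
  have h20 := Complex.slitPlane_ne_zero h2
  have hpow : (1 + z * w) ^ (-((N + N * Q₀ - k : ℝ) : ℂ)) =
      (1 + z * w) ^ k * ((1 + z * w) ^ ((N + N * Q₀ : ℝ) : ℂ))⁻¹ := by
    rw [← Complex.cpow_natCast, ← Complex.cpow_neg, ← Complex.cpow_add _ _ h20]
    push_cast
    ring_nf
  have hbin : (1 + z * w) ^ k =
      ∑ i ∈ Finset.range (k + 1), (w : ℂ) ^ i * (k.choose i : ℂ) * z ^ i := by
    rw [add_comm, add_pow]
    refine Finset.sum_congr rfl fun i _ => ?_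
    rw [one_pow, mul_pow]; ring
  have hz1 : (z ^ (k + 1))⁻¹ = z ^ (n - 1 - k) * (z ^ n)⁻¹ := by
    rw [eq_mul_inv_iff_mul_eq₀ (pow_ne_zero _ h0), inv_mul_eq_iff_eq_mul₀ (pow_ne_zero _ h0),
      ← pow_add]
    congr 1
    omega
  rw [contourKernel, contourWeight_eq_of_mem_cutPlane N Q₀ Q₁ hw n hz, hpow, hbin, hz1,
    Finset.sum_mul, Finset.mul_sum]
  refine Finset.sum_congr rfl fun i _ => ?_
  rw [pow_add, div_eq_mul_inv _ ((1 + z * (w : ℂ)) ^ _ * z ^ n), mul_inv]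
  ring

theorem continuousOn_contourWeight (N Q₀ Q₁ : ℝ) {w : ℝ} (hw : 0 < w) (n : ℕ) :
    ContinuousOn (contourWeight N Q₀ Q₁ w n) (cutPlane (-1 / w) w) := by
  refine ContinuousOn.congr (fun z hz => ?_)
    fun z hz => contourWeight_eq_of_mem_cutPlane N Q₀ Q₁ hw n hz
  obtain ⟨h0, h1, h2⟩ := mem_slitPlane_of_mem_cutPlane hw hz
  refine ContinuousAt.continuousWithinAt (ContinuousAt.div ?_ ?_ ?_)
  · exact (continuousAt_const.sub (continuousAt_const.div continuousAt_id h0)).cpow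
      continuousAt_const h1
  · exact (ContinuousAt.cpow (f := fun z : ℂ => 1 + z * w) (by fun_prop) continuousAt_const h2).mul
      (by fun_prop)
  · exact mul_ne_zero (by simp [Complex.cpow_eq_zero_iff, Complex.slitPlane_ne_zero h2])
      (pow_ne_zero _ h0)

theorem planarIntegrand_eq_planarDensity (N Q₀ Q₁ w : ℝ) (P : Polynomial ℂ) (k : ℕ) :
    planarIntegrand N Q₀ Q₁ w P k = planarDensity w (N * Q₁) (N + N * Q₀ - k) k P := by
  ext z
  rw [planarIntegrand, planarWeight, planarDensity_eq]
  ring_nf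

/-- Relation `k` involves only `c (n-1-k), …, c (n-1)`, and its first term has coefficient `1`.
Strong induction on `k` solves the system from the top index down. -/
theorem forall_binomial_sum_eq_zero_iff {R : Type*} [CommRing R] (w : R) (c : ℕ → R) (n : ℕ) :
    (∀ k < n, ∑ i ∈ Finset.range (k + 1), w ^ i * (k.choose i : R) * c (n - 1 - k + i) = 0) ↔
      ∀ j < n, c j = 0 := by
  constructor
  · intro h
    have key : ∀ k < n, c (n - 1 - k) = 0 := by
      intro k
      induction k using Nat.strong_induction_on with
      | _ k ih =>
        intro hk
        have h1 := h k hk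
        rw [Finset.sum_range_succ'] at h1
        rw [Finset.sum_eq_zero fun i hi => ?_] at h1
        · simpa using h1
        · have hi' := Finset.mem_range.1 hi
          have h2 := ih (k - (i + 1)) (by omega) (by omega)
          rw [show n - 1 - (k - (i + 1)) = n - 1 - k + (i + 1) by omega] at h2
          rw [h2, mul_zero]
    intro j hj
    have := key (n - 1 - j) (by omega)
    rwa [show n - 1 - (n - 1 - j) = j by omega] at this
  · intro h k hk
    refine Finset.sum_eq_zero fun i hi => ?_
    have hi' := Finset.mem_range.1 hi
    rw [h _ (by omega), mul_zero]

end ContourOrth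

end

/-! ### The equivalence of the two orthogonalities -/

theorem proposition1p2 (N Q₀ Q₁ w : ℝ) (hN : 0 < N) (hQ₀ : 0 < Q₀) (hQ₁ : 0 < Q₁) (hw : 0 < w)
    (n : ℕ) (hn : (n : ℝ) < N + N * Q₀ + 1 / 2)
    (P : Polynomial ℂ) (hP : P.natDegree ≤ n)
    (a : ℂ) (γ : Path a a) (hγ : ContourOrth.IsAdmissibleContour w γ) :
    ContourOrth.PlanarOrthogonal N Q₀ Q₁ w n P ↔
      ContourOrth.ContourOrthogonal N Q₀ Q₁ w n P γ := by
  open ContourOrth in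
  have hr := hγ.range_subset_cutPlane
  have hq : 0 < N * Q₁ := mul_pos hN hQ₁
  have hcont : ∀ j, ContinuousOn (fun z => P.eval z * z ^ j * contourWeight N Q₀ Q₁ w n z)
      (Set.range γ) := fun j =>
    (Continuous.continuousOn (P.continuous.mul (by fun_prop))).mul
      ((continuousOn_contourWeight N Q₀ Q₁ hw n).mono hr)
  have hsum : ∀ k < n, contourIntegral γ (contourKernel w (N * Q₁) (N + N * Q₀ - k) k P) =
      ∑ i ∈ Finset.range (k + 1), (w : ℂ) ^ i * (k.choose i : ℂ) *
        contourIntegral γ (fun z => P.eval z * z ^ (n - 1 - k + i) *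
          contourWeight N Q₀ Q₁ w n z) := fun k hk => by
    rw [contourIntegral_congr fun z hz => contourKernel_eq N Q₀ Q₁ hw hk P (hr hz),
      contourIntegral_sum _ hγ.piecewiseC1 fun i _ => continuousOn_const.fun_mul (hcont _)]
    exact Finset.sum_congr rfl fun i _ => contourIntegral_const_mul _ _
  have hplanar : ∀ k < n, MeasureTheory.Integrable (planarIntegrand N Q₀ Q₁ w P k) ∧
      (∫ z : ℂ, planarIntegrand N Q₀ Q₁ w P k z = 0 ↔
        contourIntegral γ (contourKernel w (N * Q₁) (N + N * Q₀ - k) k P) = 0) := fun k hk => by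
    have hk' : (k : ℝ) + 1 ≤ n := by exact_mod_cast hk
    -- With `k ≤ n - 1`, the bound on `n` gives `m > 1/2`. The next inequality, which yields
    -- integrability and decay, is where the margin `1/2` is exactly used: in the worst case `k = n
    -- - 1` it reads `2n < 2(N + N Q₀) + 1`.
    have hm : 0 < N + N * Q₀ - k := by linarith
    have hnk : (n : ℝ) < 2 * (N + N * Q₀ - k) + k := by linarith
    obtain ⟨B, hB, h⟩ := integral_planarDensity_eq hw hq hm hnk
    have h2I : 2 * Complex.I ≠ 0 := mul_ne_zero two_ne_zero Complex.I_ne_zero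
    rw [planarIntegrand_eq_planarDensity]
    refine ⟨integrable_planarDensity hw hq hm hnk hP, ?_⟩
    rw [hγ.contourIntegral_eq_rectIntegral hw (differentiableOn_contourKernel hw _ _ k P),
      ← mul_eq_zero_iff_left h2I, h P hP, mul_eq_zero_iff_left hB]
  rw [PlanarOrthogonal, ContourOrthogonal]
  calc _ ↔ ∀ k < n, contourIntegral γ (contourKernel w (N * Q₁) (N + N * Q₀ - k) k P) = 0 :=
        forall₂_congr fun k hk => (and_iff_right (hplanar k hk).1).trans (hplanar k hk).2
    _ ↔ ∀ k < n, ∑ i ∈ Finset.range (k + 1), (w : ℂ) ^ i * (k.choose i : ℂ) *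
        contourIntegral γ (fun z => P.eval z * z ^ (n - 1 - k + i) *
          contourWeight N Q₀ Q₁ w n z) = 0 := forall₂_congr fun k hk => by rw [hsum k hk]
    _ ↔ ∀ j < n, contourIntegral γ
        (fun z => P.eval z * z ^ j * contourWeight N Q₀ Q₁ w n z) = 0 :=
      forall_binomial_sum_eq_zero_iff (w : ℂ) (fun j => contourIntegral γ
        (fun z => P.eval z * z ^ j * contourWeight N Q₀ Q₁ w n z)) n
    _ ↔ _ := forall₂_congr fun j _ =>
      (and_iff_right (hγ.piecewiseC1.contourIntegrable (hcont j))).symm
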